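/- Let $K$ be a field, $\theta$ an automorphism of $K$ of finite order $r\ge 1$, and $F=\{a\in K:\theta(a)=a\}$. Let $\mathcal A=K[X^{\pm1};\theta]$ be the ring of skew Laurent polynomials ($Xa=\theta(a)X$ for $a\in K$), put $Y=X^r$, and let $\mathrm{Frac}(\mathcal A)$ be its field of fractions, that is, the ring of fractions $D^{-1}g$ with $g\in\mathcal A$ and $0\ne D\in F[Y]$. Let $F^{\mathrm s}$ be a separable closure of $F$. For $z\in F^{\mathrm s}$, $z\neq0$, with minimal polynomial $N\in F[Y]$ over $F$, a $z$-admissible morphism is a homomorphism of $K$-algebras $\tau_z:\varprojlim_m\mathcal A/N^m\mathcal A\to(\mathcal A/N\mathcal A)[[T]]$ such that $\tau_z(X)\equiv X\pmod T$ and $\tau_z(Y)=z+T$, where $z$ on the right is the class of $Y$ in $\mathcal A/N\mathcal A$. It induces a ring homomorphism $\mathrm{TS}_z:\mathrm{Frac}(\mathcal A)\to(\mathcal A/N\mathcal A)((T))$. For $f\in\mathrm{Frac}(\mathcal A)$ the $0$-th partial skew residues, all viewed in $K\otimes_FF^{\mathrm s}$ (with $c\in K$ identified with $c\otimes1$), are: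 - for $z\in F^{\mathrm s}$, $z\ne0$: $\mathrm{sres}_{z,0}(f)=\iota_z\big(\sec_0(\text{coefficient of }T^{-1}\text{ in }\mathrm{TS}_z(f))\big)$, where $\sec_0:\mathcal A/N\mathcal A\to K[Y^{\pm1}]/N$ is induced by $\sum_n a_nX^n\mapsto\sum_i a_{ir}Y^i$ and $\iota_z:K[Y^{\pm1}]/N\to K\otimes_FF^{\mathrm s}$ is given by $aY^i\mapsto a\otimes z^i$; - $\mathrm{sres}_{0,0}(f)$ is the coefficient of $X^{-r}$ in the expansion of $f$ in the ring of skew Laurent series $K((X;\theta))$; - $\mathrm{sres}_{\infty,0}(f)$ is the opposite of the coefficient of $\tilde X^{r}$ in the expansion of $f$ in $K((\tilde X;\theta^{-1}))$, where $\tilde X=X^{-1}$. Then a $z$-admissible morphism exists for every nonzero $z\in F^{\mathrm s}$. Moreover, for every choice of such morphisms and for every $f\in\mathrm{Frac}(\mathcal A)$ all of whose finite poles lie in $F^{\mathrm s}$ (that is, $Df\in\mathcal A$ for some nonzero $D\in F[Y]$ which splits into linear factors over $F^{\mathrm s}$; this holds for every $f$ when $F$ is perfect), only finitely many of the $\mathrm{sres}_{z,0}(f)$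 are nonzero, and $$\sum_{z\in F^{\mathrm s}\sqcup\{\infty\}}\mathrm{sres}_{z,0}(f)=0.$$ -/

import Mathlib

open scoped Polynomial LaurentPolynomial TensorProduct OnePoint

noncomputable section

namespace SkewResidue

variable {K : Type*} [Field K]

/-- The subfield `F` of `K` fixed by `θ`. -/
abbrev fixedField (θ : RingAut K) : Subfield K :=
  (θ : K →+* K).eqLocusField (RingHom.id K)

/-- The action of `ℤ` on `K` through the powers of `θ`. -/
abbrev powAction (θ : RingAut K) : MulSemiringAction (Multiplicative ℤ) K :=
  MulSemiringAction.compHom K (zpowersHom (RingAut K) θ)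

/-- The ring `𝒜 = K[X^{±1}; θ]` of skew Laurent polynomials: finite sums `∑ aᵢ Xⁱ` (`i ∈ ℤ`) with
`(a Xⁱ) (b Xʲ) = a θⁱ(b) Xⁱ⁺ʲ`. -/
def SkewLaurent (_ : RingAut K) : Type _ := SkewMonoidAlgebra K (Multiplicative ℤ)

namespace SkewLaurent

variable (θ : RingAut K)

instance : Ring (SkewLaurent θ) :=
  letI := powAction θ
  inferInstanceAs (Ring (SkewMonoidAlgebra K (Multiplicative ℤ)))

/-- The coefficient of `Xⁿ` (coefficients are written on the left). -/
def coeff (n : ℤ) : SkewLaurent θ →+ K where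
  toFun f := SkewMonoidAlgebra.coeff f (Multiplicative.ofAdd n)
  map_zero' := rfl
  map_add' f g := DFunLike.congr_fun (SkewMonoidAlgebra.coeff_add f g) _

/-- The monomial `a Xⁿ`. -/
def monomial (n : ℤ) : K →+ SkewLaurent θ where
  toFun a := (SkewMonoidAlgebra.single (Multiplicative.ofAdd n) a :)
  map_zero' := SkewMonoidAlgebra.single_zero _
  map_add' := SkewMonoidAlgebra.single_add _

theorem monomial_mul_monomial (m n : ℤ) (a b : K) :
    monomial θ m a * monomial θ n b = monomial θ (m + n) (a * (θ ^ m) b) :=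
  letI := powAction θ
  SkewMonoidAlgebra.single_mul_single

theorem one_def : (1 : SkewLaurent θ) = monomial θ 0 1 := rfl

theorem coeff_monomial (m n : ℤ) (a : K) :
    coeff θ m (monomial θ n a) = if n = m then a else 0 := by
  classical
  refine (SkewMonoidAlgebra.coeff_single_apply (a := Multiplicative.ofAdd n)
    (a' := Multiplicative.ofAdd m)).trans ?_
  simp

theorem induction_on {P : SkewLaurent θ → Prop} (f : SkewLaurent θ)
    (h0 : P 0) (hm : ∀ n a, P (monomial θ n a)) (ha : ∀ f g, P f → P g → P (f + g)) : P f :=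
  SkewMonoidAlgebra.induction_on (p := P) f h0 (fun n a => hm n.toAdd a) (fun f g => ha f g)

/-- Constants, `K → 𝒜`. -/
def C : K →+* SkewLaurent θ where
  toFun a := monomial θ 0 a
  map_zero' := map_zero _
  map_one' := rfl
  map_add' := map_add _
  map_mul' a b := by rw [monomial_mul_monomial]; simp

/-- The variable `X`. -/
def X : SkewLaurent θ := monomial θ 1 1

theorem X_pow (n : ℕ) : X θ ^ n = monomial θ n 1 := by
  induction n with
  | zero => rfl
  | succ n ih => rw [pow_succ, ih, X, monomial_mul_monomial]; simp

/-- The ring homomorphism `𝒜 → R` which is `φ` on `K` and sends `X` to the unit `x`, when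
`x φ(a) = φ(θ(a)) x` for all `a ∈ K`. -/
def lift {R : Type*} [Ring R] (φ : K →+* R) (x : Rˣ)
    (h : ∀ a, (x : R) * φ a = φ (θ a) * x) : SkewLaurent θ →+* R :=
  letI := powAction θ
  SkewMonoidAlgebra.liftNCRingHom φ ((Units.coeHom R).comp (zpowersHom Rˣ x)) (by
    have key : ∀ n : ℤ, ∀ a, φ ((θ ^ n) a) * ((x ^ n : Rˣ) : R) = ((x ^ n : Rˣ) : R) * φ a := by
      have hinv : ∀ a, ((x⁻¹ : Rˣ) : R) * φ a = φ ((θ⁻¹ : RingAut K) a) * ((x⁻¹ : Rˣ) : R) := by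
        intro a
        rw [Units.inv_mul_eq_iff_eq_mul, ← mul_assoc, Units.eq_mul_inv_iff_mul_eq, h]
        rw [← RingAut.mul_apply, mul_inv_cancel, RingAut.one_apply]
      intro n
      induction n with
      | zero => simp
      | succ n ih =>
        intro a
        rw [zpow_add_one, zpow_add_one, RingAut.mul_apply, Units.val_mul, ← mul_assoc, ih,
          mul_assoc, ← h, mul_assoc]
      | pred n ih =>
        intro a
        rw [zpow_sub_one, zpow_sub_one, RingAut.mul_apply, Units.val_mul, ← mul_assoc, ih,
          mul_assoc, ← hinv, mul_assoc]
    intro a n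
    exact key n.toAdd a)

theorem lift_monomial {R : Type*} [Ring R] (φ : K →+* R) (x : Rˣ)
    (h : ∀ a, (x : R) * φ a = φ (θ a) * x) (n : ℤ) (a : K) :
    lift θ φ x h (monomial θ n a) = φ a * ((x ^ n : Rˣ) : R) := by
  let := powAction θ
  exact SkewMonoidAlgebra.liftNC_single _ _ _ _

end SkewLaurent

open SkewLaurent

variable (θ : RingAut K)

/-- The homomorphism `𝒵⁺ = F[Y] → 𝒜`, `Y ↦ X^r`, where `r` is the order of `θ`. -/
def ofCenter : (fixedField θ)[X] →+* SkewLaurent θ :=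
  Polynomial.eval₂RingHom' ((SkewLaurent.C θ).comp (fixedField θ).subtype)
    (SkewLaurent.X θ ^ orderOf θ) (fun a => by
      rw [X_pow]
      change monomial θ 0 (a : K) * _ = _ * monomial θ 0 (a : K)
      rw [monomial_mul_monomial, monomial_mul_monomial]
      simp [pow_orderOf_eq_one])

theorem ofCenter_monomial (n : ℕ) (a : fixedField θ) :
    ofCenter θ (Polynomial.monomial n a) = monomial θ ((orderOf θ : ℤ) * n) (a : K) := by
  change Polynomial.eval₂ _ _ _ = _
  rw [Polynomial.eval₂_monomial, ← pow_mul, X_pow]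
  change monomial θ 0 (a : K) * _ = _
  rw [monomial_mul_monomial]
  simp

theorem ofCenter_commute (p : (fixedField θ)[X]) (f : SkewLaurent θ) :
    Commute (ofCenter θ p) f := by
  induction p using Polynomial.induction_on' with
  | add p q hp hq => rw [map_add]; exact hp.add_left hq
  | monomial n a =>
    rw [ofCenter_monomial]
    induction f using SkewLaurent.induction_on with
    | h0 => exact Commute.zero_right _
    | ha f g hf hg => exact hf.add_right hg
    | hm m b =>
      have ha : ∀ k : ℤ, (θ ^ k) (a : K) = a := by
        have h1 : θ (a : K) = a := a.2
        have h2 : (θ⁻¹ : RingAut K) (a : K) = a := by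
          conv_lhs => rw [← h1]
          rw [← RingAut.mul_apply, inv_mul_cancel, RingAut.one_apply]
        intro k
        induction k with
        | zero => rfl
        | succ n ih => rw [zpow_add_one, RingAut.mul_apply, h1, ih]
        | pred n ih => rw [zpow_sub_one, RingAut.mul_apply, h2, ih]
      change _ * _ = _ * _
      rw [monomial_mul_monomial, monomial_mul_monomial, ha, zpow_mul, zpow_natCast,
        zpow_natCast, pow_orderOf_eq_one, one_pow, RingAut.one_apply, mul_comm b, add_comm]

/-! ### The fraction field -/

/-- The multiplicative set of the nonzero elements of `𝒵⁺ = F[Y]`, in `𝒜`. -/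
def denominators : Submonoid (SkewLaurent θ) :=
  (nonZeroDivisors (fixedField θ)[X]).map (ofCenter θ)

instance : OreLocalization.OreSet (denominators θ) where
  ore_right_cancel a b s h := by
    obtain ⟨_, p, _, rfl⟩ := s
    refine ⟨⟨_, p, ‹_›, rfl⟩, ?_⟩
    have h1 := ofCenter_commute θ p a
    have h2 := ofCenter_commute θ p b
    exact h1.eq.trans (h.trans h2.eq.symm)
  oreNum a _ := a
  oreDenom _ s := s
  ore_eq a s := by
    obtain ⟨_, p, _, rfl⟩ := s
    exact ofCenter_commute θ p a

/-- `Frac(𝒜) = Frac(𝒵) ⊗ 𝒜`: the fractions `D⁻¹ g` with `g ∈ 𝒜` and `0 ≠ D ∈ F[Y]`. -/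
abbrev SkewFrac : Type _ := OreLocalization (denominators θ) (SkewLaurent θ)

/-- The inclusion `𝒜 → Frac(𝒜)`. -/
def toFrac : SkewLaurent θ →+* SkewFrac θ := OreLocalization.numeratorRingHom

variable {θ} in
/-- The extension to `Frac(𝒜)` of a ring homomorphism defined on `𝒜` which sends nonzero elements of
`F[Y]` to units: `D⁻¹ g ↦ φ(D)⁻¹ φ(g)`. -/
def fracLift {R : Type*} [Ring R] (φ : SkewLaurent θ →+* R)
    (h : ∀ D : (fixedField θ)[X], D ≠ 0 → IsUnit (φ (ofCenter θ D))) : SkewFrac θ →+* R :=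
  OreLocalization.universalHom φ
    (IsUnit.liftRight ((φ : SkewLaurent θ →* R).comp (denominators θ).subtype) (by
      rintro ⟨_, p, hp, rfl⟩
      exact h p (nonZeroDivisors.ne_zero hp)))
    (fun _ => rfl)

variable {θ} in
theorem fracLift_toFrac {R : Type*} [Ring R] (φ : SkewLaurent θ →+* R)
    (h : ∀ D : (fixedField θ)[X], D ≠ 0 → IsUnit (φ (ofCenter θ D))) (f : SkewLaurent θ) :
    fracLift φ h (toFrac θ f) = φ f :=
  OreLocalization.universalHom_commutes _ _ _

/-- A homomorphism from power series over a field which inverts the variable inverts every nonzero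
power series. -/
theorem isUnit_map_powerSeries {E R : Type*} [Field E] [Ring R] (ψ : PowerSeries E →+* R)
    (hψ : IsUnit (ψ PowerSeries.X)) (q : PowerSeries E) (hq : q ≠ 0) : IsUnit (ψ q) := by
  have h : q = (PowerSeries.X : PowerSeries E) ^ q.order.toNat *
      (PowerSeries.Unit_of_divided_by_X_pow_order q : PowerSeries E) := by
    rw [PowerSeries.Unit_of_divided_by_X_pow_order_nonzero hq]
    exact PowerSeries.X_pow_order_mul_divXPowOrder.symm
  rw [h, map_mul, map_pow]
  exact (hψ.pow _).mul ((Units.isUnit _).map ψ)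

/-! ### Skew Laurent series -/

/-- An automorphism of `K`, as an additive endomorphism of `K`. -/
def toEnd : RingAut K →* Module.End ℤ K where
  toFun σ := (σ : K →+ K).toIntLinearMap
  map_one' := rfl
  map_mul' _ _ := rfl

/-- Multiplication by `a`, as an additive endomorphism of `K`. -/
def mulEnd : K →+* Module.End ℤ K where
  toFun a := LinearMap.mulLeft ℤ a
  map_zero' := by ext; simp
  map_one' := by ext; simp
  map_add' a b := by ext; simp [add_mul]
  map_mul' a b := by ext; simp

theorem toEnd_mul_mulEnd (σ : RingAut K) (a : K) :
    toEnd σ * mulEnd a = mulEnd (σ a) * toEnd σ := by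
  ext x
  exact map_mul σ a x

/-- The ring `K((X; θ))` of skew Laurent series `∑ aᵢ Xⁱ`, in which `X a = θ(a) X`. The series
`∑ aᵢ Xⁱ` is represented by the Laurent series in a central variable with `i`-th coefficient the
additive endomorphism `x ↦ aᵢ θⁱ(x)` of `K`; indeed `(a θⁱ) ∘ (b θʲ) = a θⁱ(b) θⁱ⁺ʲ`. -/
def SkewLaurentSeries : Subring (LaurentSeries (Module.End ℤ K)) where
  carrier := {s | ∀ i : ℤ, ∃ a : K, s.coeff i = mulEnd a * toEnd (θ ^ i)}
  zero_mem' i := ⟨0, by simp⟩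
  one_mem' i := by
    by_cases hi : i = 0
    · subst hi; exact ⟨1, by simp⟩
    · exact ⟨0, by simp [HahnSeries.coeff_one, hi]⟩
  add_mem' {s t} hs ht i := by
    obtain ⟨a, ha⟩ := hs i
    obtain ⟨b, hb⟩ := ht i
    exact ⟨a + b, by rw [HahnSeries.coeff_add, ha, hb, map_add, add_mul]⟩
  neg_mem' {s} hs i := by
    obtain ⟨a, ha⟩ := hs i
    exact ⟨-a, by rw [HahnSeries.coeff_neg, ha, map_neg, neg_mul]⟩
  mul_mem' {s t} hs ht i := by
    choose a ha using hs
    choose b hb using ht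
    refine ⟨∑ ij ∈ Finset.antidiagonal s.isPWO_support t.isPWO_support i,
      a ij.1 * (θ ^ ij.1) (b ij.2), ?_⟩
    rw [HahnSeries.coeff_mul, map_sum, Finset.sum_mul]
    refine Finset.sum_congr rfl fun ij hij => ?_
    obtain ⟨-, -, rfl⟩ := Finset.mem_antidiagonal.1 hij
    rw [ha, hb, zpow_add, map_mul, map_mul, mul_assoc, ← mul_assoc (toEnd _) (mulEnd _),
      toEnd_mul_mulEnd, mul_assoc, mul_assoc]

/-- The coefficient `aᵢ` of `Xⁱ` in a skew Laurent series `∑ aᵢ Xⁱ`. -/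
def SkewLaurentSeries.coeff (i : ℤ) : SkewLaurentSeries θ →+ K where
  toFun s := (s : LaurentSeries (Module.End ℤ K)).coeff i 1
  map_zero' := rfl
  map_add' _ _ := rfl

/-- The unit `X` of `K((X; θ))`, viewed in the ambient ring of Laurent series. -/
def seriesX : (LaurentSeries (Module.End ℤ K))ˣ where
  val := HahnSeries.single 1 (toEnd θ)
  inv := HahnSeries.single (-1) (toEnd θ⁻¹)
  val_inv := by
    rw [HahnSeries.single_mul_single, ← map_mul, mul_inv_cancel, map_one]; rfl
  inv_val := by
    rw [HahnSeries.single_mul_single, ← map_mul, inv_mul_cancel, map_one]; rfl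

theorem seriesX_zpow (n : ℤ) :
    ((seriesX θ ^ n : (LaurentSeries (Module.End ℤ K))ˣ) : LaurentSeries (Module.End ℤ K)) =
      HahnSeries.single n (toEnd (θ ^ n)) := by
  induction n with
  | zero => rfl
  | succ n ih =>
    rw [zpow_add_one, Units.val_mul, ih]
    change _ * HahnSeries.single 1 (toEnd θ) = _
    rw [HahnSeries.single_mul_single, ← map_mul, zpow_add_one]
  | pred n ih =>
    rw [zpow_sub_one, Units.val_mul, ih]
    change _ * HahnSeries.single (-1) (toEnd θ⁻¹) = _
    rw [HahnSeries.single_mul_single, ← map_mul, zpow_sub_one]; rfl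

/-- The inclusion of `𝒜` in the ambient ring of Laurent series. -/
def toSeriesAux : SkewLaurent θ →+* LaurentSeries (Module.End ℤ K) :=
  SkewLaurent.lift θ (HahnSeries.C.comp mulEnd) (seriesX θ) (fun a => by
    change HahnSeries.single 1 (toEnd θ) * HahnSeries.single 0 (mulEnd a) =
      HahnSeries.single 0 (mulEnd (θ a)) * HahnSeries.single 1 (toEnd θ)
    rw [HahnSeries.single_mul_single, HahnSeries.single_mul_single, toEnd_mul_mulEnd]; rfl)

theorem toSeriesAux_monomial (n : ℤ) (a : K) :
    toSeriesAux θ (monomial θ n a) = HahnSeries.single n (mulEnd a * toEnd (θ ^ n)) := by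
  rw [toSeriesAux, lift_monomial, seriesX_zpow]
  change HahnSeries.single 0 (mulEnd a) * _ = _
  rw [HahnSeries.single_mul_single, zero_add]

theorem toSeriesAux_coeff (f : SkewLaurent θ) (i : ℤ) :
    (toSeriesAux θ f).coeff i = mulEnd (SkewLaurent.coeff θ i f) * toEnd (θ ^ i) := by
  induction f using SkewLaurent.induction_on with
  | h0 => simp
  | ha f g hf hg => rw [map_add, HahnSeries.coeff_add, hf, hg, map_add, map_add, add_mul]
  | hm n a =>
    rw [toSeriesAux_monomial, SkewLaurent.coeff_monomial]
    by_cases h : n = i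
    · subst h; simp
    · rw [HahnSeries.coeff_single_of_ne (Ne.symm h)]; simp [h]

/-- The inclusion `𝒜 → K((X; θ))`, which sends `∑ aᵢ Xⁱ` to `∑ aᵢ Xⁱ`. -/
def toSeries : SkewLaurent θ →+* SkewLaurentSeries θ :=
  (toSeriesAux θ).codRestrict (SkewLaurentSeries θ) (fun f i => ⟨_, toSeriesAux_coeff θ f i⟩)

theorem toSeries_coeff (f : SkewLaurent θ) (i : ℤ) :
    SkewLaurentSeries.coeff θ i (toSeries θ f) = SkewLaurent.coeff θ i f := by
  change (toSeriesAux θ f).coeff i 1 = _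
  rw [toSeriesAux_coeff]
  change SkewLaurent.coeff θ i f * (θ ^ i) 1 = _
  rw [map_one, mul_one]

/-- The homomorphism `F[[Y]] → K((X; θ))`, `Y ↦ X^n`, for a subfield `F` and an integer `n > 0` with
`θⁿ = 1`. -/
def ofPowerSeries (F : Subfield K) (n : ℕ) (hn : 0 < n) (hθ : θ ^ n = 1) :
    PowerSeries F →+* SkewLaurentSeries θ :=
  ((HahnSeries.embDomainRingHom ((AddMonoidHom.mulLeft (n : ℤ)).comp (Nat.castAddMonoidHom ℤ))
      (fun a b h => by simpa [hn.ne'] using h)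
      (fun a b => by simp [hn])).comp
    ((HahnSeries.toPowerSeries (R := Module.End ℤ K)).symm.toRingHom.comp
      (PowerSeries.map (mulEnd.comp F.subtype)))).codRestrict (SkewLaurentSeries θ) (by
    intro q i
    by_cases h : ∃ m : ℕ, (n : ℤ) * m = i
    · obtain ⟨m, rfl⟩ := h
      refine ⟨(PowerSeries.coeff m q : F), ?_⟩
      rw [zpow_mul, zpow_natCast, zpow_natCast, hθ, one_pow, map_one, mul_one]
      refine (HahnSeries.embDomain_coeff (a := m)).trans ?_
      simp
    · refine ⟨0, ?_⟩
      rw [map_zero, zero_mul]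
      refine HahnSeries.embDomain_of_notMem_range ?_
      rintro ⟨m, hm⟩
      exact h ⟨m, hm⟩)

theorem ofPowerSeries_monomial (F : Subfield K) (n : ℕ) (hn : 0 < n) (hθ : θ ^ n = 1)
    (m : ℕ) (a : F) :
    ofPowerSeries θ F n hn hθ (PowerSeries.monomial m a) =
      toSeries θ (monomial θ ((n : ℤ) * m) (a : K)) := by
  apply Subtype.ext
  change _ = toSeriesAux θ _
  rw [toSeriesAux_monomial, zpow_mul, zpow_natCast, zpow_natCast, hθ, one_pow, map_one, mul_one]
  have h : (HahnSeries.toPowerSeries (R := Module.End ℤ K)).symm.toRingHom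
      (PowerSeries.map (mulEnd.comp F.subtype) (PowerSeries.monomial m a)) =
      HahnSeries.single m (mulEnd (a : K)) := by
    ext1
    funext k
    rcases eq_or_ne k m with rfl | hk
    · simp
    · simp [HahnSeries.coeff_single_of_ne hk, PowerSeries.coeff_monomial, hk]
  change HahnSeries.embDomain _ ((HahnSeries.toPowerSeries (R := Module.End ℤ K)).symm.toRingHom
      (PowerSeries.map (mulEnd.comp F.subtype) (PowerSeries.monomial m a))) = _
  rw [h, HahnSeries.embDomain_single]
  rfl

theorem isUnit_toSeries_monomial (n : ℤ) : IsUnit (toSeries θ (monomial θ n 1)) := by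
  refine IsUnit.map (toSeries θ) ⟨⟨monomial θ n 1, monomial θ (-n) 1, ?_, ?_⟩, rfl⟩ <;>
  · rw [monomial_mul_monomial]
    simp [SkewLaurent.one_def]

theorem isUnit_ofPowerSeries (F : Subfield K) (n : ℕ) (hn : 0 < n) (hθ : θ ^ n = 1)
    (q : PowerSeries F) (hq : q ≠ 0) : IsUnit (ofPowerSeries θ F n hn hθ q) := by
  refine isUnit_map_powerSeries _ ?_ q hq
  rw [PowerSeries.X_eq, ofPowerSeries_monomial]
  exact isUnit_toSeries_monomial θ _

theorem isUnit_toSeries_ofCenter (hθ : IsOfFinOrder θ) (D : (fixedField θ)[X]) (hD : D ≠ 0) :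
    IsUnit (toSeries θ (ofCenter θ D)) := by
  have h : (toSeries θ).comp (ofCenter θ) =
      (ofPowerSeries θ (fixedField θ) (orderOf θ) hθ.orderOf_pos (pow_orderOf_eq_one θ)).comp
        Polynomial.coeToPowerSeries.ringHom := by
    refine RingHom.ext fun p => ?_
    induction p using Polynomial.induction_on' with
    | add p q hp hq => rw [map_add, map_add, hp, hq]
    | monomial k a => simp [ofCenter_monomial, ofPowerSeries_monomial]
  have h' := DFunLike.congr_fun h D
  simp only [RingHom.comp_apply] at h'
  rw [h']
  exact isUnit_ofPowerSeries θ _ _ _ _ _ (by simpa using hD)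

/-- The Taylor expansion at `0`, `TS₀ : Frac(𝒜) → K((X; θ))`: the extension of the inclusion
`𝒜 → K((X; θ))`. -/
def taylorZero (hθ : IsOfFinOrder θ) : SkewFrac θ →+* SkewLaurentSeries θ :=
  fracLift (toSeries θ) (isUnit_toSeries_ofCenter θ hθ)

/-- The isomorphism `K[X^{±1}; θ] → K[X̃^{±1}; θ⁻¹]`, `X ↦ X̃⁻¹`. -/
def invertX : SkewLaurent θ →+* SkewLaurent θ⁻¹ :=
  SkewLaurent.lift θ (SkewLaurent.C θ⁻¹)
    ⟨monomial θ⁻¹ (-1) 1, monomial θ⁻¹ 1 1,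
      by rw [monomial_mul_monomial]; simp [SkewLaurent.one_def],
      by rw [monomial_mul_monomial]; simp [SkewLaurent.one_def]⟩
    (fun a => by
      change monomial θ⁻¹ (-1) 1 * monomial θ⁻¹ 0 a = monomial θ⁻¹ 0 (θ a) * monomial θ⁻¹ (-1) 1
      rw [monomial_mul_monomial, monomial_mul_monomial]
      simp)

theorem invertX_monomial (n : ℤ) (a : K) :
    invertX θ (monomial θ n a) = monomial θ⁻¹ (-n) a := by
  have key : ∀ (x : (SkewLaurent θ⁻¹)ˣ), (x : SkewLaurent θ⁻¹) = monomial θ⁻¹ (-1) 1 →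
      ((x⁻¹ : (SkewLaurent θ⁻¹)ˣ) : SkewLaurent θ⁻¹) = monomial θ⁻¹ 1 1 →
      ∀ n : ℤ, ((x ^ n : (SkewLaurent θ⁻¹)ˣ) : SkewLaurent θ⁻¹) = monomial θ⁻¹ (-n) 1 := by
    intro x hx hx' n
    induction n with
    | zero => rfl
    | succ n ih =>
      rw [zpow_add_one, Units.val_mul, ih, hx, monomial_mul_monomial, map_one, mul_one, neg_add]
    | pred n ih =>
      rw [zpow_sub_one, Units.val_mul, ih, hx', monomial_mul_monomial, map_one, mul_one]
      congr 1
      ring_nf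
  rw [invertX, lift_monomial, key _ rfl rfl]
  change monomial θ⁻¹ 0 a * _ = _
  rw [monomial_mul_monomial]
  simp

theorem isUnit_toSeries_invertX (hθ : IsOfFinOrder θ) (D : (fixedField θ)[X]) (hD : D ≠ 0) :
    IsUnit (toSeries θ⁻¹ (invertX θ (ofCenter θ D))) := by
  have hr : (θ⁻¹ : RingAut K) ^ orderOf θ = 1 := by rw [inv_pow, pow_orderOf_eq_one, inv_one]
  have key : ∀ N : ℕ, ∀ p : (fixedField θ)[X], p.natDegree ≤ N →
      toSeries θ⁻¹ (monomial θ⁻¹ ((orderOf θ : ℤ) * N) 1) *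
        toSeries θ⁻¹ (invertX θ (ofCenter θ p)) =
      ofPowerSeries θ⁻¹ (fixedField θ) (orderOf θ) hθ.orderOf_pos hr
        (p.reflect N : (fixedField θ)[X]) := by
    intro N p hp
    refine Polynomial.induction_with_natDegree_le (fun p => toSeries θ⁻¹ (monomial θ⁻¹
      ((orderOf θ : ℤ) * N) 1) * toSeries θ⁻¹ (invertX θ (ofCenter θ p)) =
      ofPowerSeries θ⁻¹ (fixedField θ) (orderOf θ) hθ.orderOf_pos hr
        (p.reflect N : (fixedField θ)[X])) N ?_ ?_ ?_ p hp
    · simp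
    · intro n a _ hn
      rw [Polynomial.reflect_C_mul_X_pow, Polynomial.C_mul_X_pow_eq_monomial,
        Polynomial.C_mul_X_pow_eq_monomial, Polynomial.revAt_le hn, ofCenter_monomial,
        invertX_monomial, Polynomial.coe_monomial, ofPowerSeries_monomial, ← map_mul,
        monomial_mul_monomial, zpow_mul, zpow_natCast, zpow_natCast, hr, one_pow, RingAut.one_apply, one_mul,
        Nat.cast_sub hn]
      congr 2
      ring_nf
    · intro f g _ _ hf hg
      rw [map_add, map_add, map_add, mul_add, hf, hg, Polynomial.reflect_add, Polynomial.coe_add,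
        map_add]
  have h := key _ D le_rfl
  have hu : IsUnit (toSeries θ⁻¹ (monomial θ⁻¹ ((orderOf θ : ℤ) * D.natDegree) 1)) :=
    isUnit_toSeries_monomial _ _
  rw [← hu.mul_left_iff, h]
  exact isUnit_ofPowerSeries θ⁻¹ _ _ _ _ _ (by simpa using hD)

/-- The Taylor expansion at infinity, `TS_∞ : Frac(𝒜) → K((X̃; θ⁻¹))`, where `X̃ = X⁻¹`. -/
def taylorInfty (hθ : IsOfFinOrder θ) : SkewFrac θ →+* SkewLaurentSeries θ⁻¹ :=
  fracLift ((toSeries θ⁻¹).comp (invertX θ)) (isUnit_toSeries_invertX θ hθ)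

/-! ### Quotients, completions and section operators -/

/-- The ideal `N𝒜` for `N ∈ F[Y]`. -/
abbrev skewIdeal (N : (fixedField θ)[X]) : Ideal (SkewLaurent θ) := Ideal.span {ofCenter θ N}

instance isTwoSided_skewIdeal (N : (fixedField θ)[X]) : (skewIdeal θ N).IsTwoSided where
  mul_mem_of_left {a} b ha := by
    obtain ⟨c, rfl⟩ := Ideal.mem_span_singleton'.1 ha
    refine Ideal.mem_span_singleton'.2 ⟨c * b, ?_⟩
    rw [mul_assoc, mul_assoc, (ofCenter_commute θ N b).eq]

/-- The quotient `𝒜/N𝒜`. -/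
abbrev SkewQuot (N : (fixedField θ)[X]) : Type _ := SkewLaurent θ ⧸ skewIdeal θ N

theorem skewIdeal_pow_le (N : (fixedField θ)[X]) {m n : ℕ} (h : m ≤ n) :
    skewIdeal θ (N ^ n) ≤ skewIdeal θ (N ^ m) := by
  refine (Ideal.span_singleton_le_iff_mem _).2 (Ideal.mem_span_singleton'.2
    ⟨ofCenter θ (N ^ (n - m)), ?_⟩)
  rw [← map_mul, ← pow_add, Nat.sub_add_cancel h]

/-- The completion `𝒜̂_N`, the inverse limit of the rings `𝒜/N^m𝒜`. -/
def SkewCompletion (N : (fixedField θ)[X]) : Subring (∀ m : ℕ, SkewQuot θ (N ^ m)) where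
  carrier := {x | ∀ (m n : ℕ) (h : m ≤ n),
    Ideal.Quotient.factor (skewIdeal_pow_le θ N h) (x n) = x m}
  zero_mem' _ _ _ := map_zero _
  one_mem' _ _ _ := map_one _
  add_mem' hx hy m n h := (map_add _ _ _).trans (congrArg₂ _ (hx m n h) (hy m n h))
  mul_mem' hx hy m n h := (map_mul _ _ _).trans (congrArg₂ _ (hx m n h) (hy m n h))
  neg_mem' hx m n h := (map_neg _ _).trans (congrArg _ (hx m n h))

/-- The natural map `𝒜 → 𝒜̂_N`. -/
def toCompletion (N : (fixedField θ)[X]) : SkewLaurent θ →+* SkewCompletion θ N :=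
  (RingHom.pi fun m => Ideal.Quotient.mk (skewIdeal θ (N ^ m))).codRestrict (SkewCompletion θ N)
    (fun _ _ _ _ => rfl)

/-- The section operator `sec_j : 𝒜 → 𝒞 = K[Y^{±1}]`, `∑ aₙ Xⁿ ↦ ∑ᵢ a_{j + i r} Yⁱ`. -/
def sec (j : ℤ) : SkewLaurent θ →+ K[T;T⁻¹] where
  toFun f := SkewMonoidAlgebra.sum f fun n a =>
    if (orderOf θ : ℤ) ∣ n.toAdd - j then
      LaurentPolynomial.C a * LaurentPolynomial.T ((n.toAdd - j) / orderOf θ) else 0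
  map_zero' := SkewMonoidAlgebra.sum_zero_index
  map_add' f g := SkewMonoidAlgebra.sum_add_index' (by simp) (by
    intros; split_ifs <;> simp [add_mul])

theorem sec_monomial (j n : ℤ) (a : K) :
    sec θ j (monomial θ n a) = if (orderOf θ : ℤ) ∣ n - j then
      LaurentPolynomial.C a * LaurentPolynomial.T ((n - j) / orderOf θ) else 0 := by
  refine (SkewMonoidAlgebra.sum_single_index (a := Multiplicative.ofAdd n) (b := a)
    (h := fun n a => if (orderOf θ : ℤ) ∣ n.toAdd - j then
      LaurentPolynomial.C a * LaurentPolynomial.T ((n.toAdd - j) / orderOf θ) else 0) ?_).trans rfl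
  simp

/-- `F[Y] → 𝒞 = K[Y^{±1}]`. -/
def toLaurent : (fixedField θ)[X] →+* K[T;T⁻¹] :=
  Polynomial.toLaurent.comp (Polynomial.mapRingHom (fixedField θ).subtype)

theorem sec_mul_ofCenter (hθ : IsOfFinOrder θ) (j : ℤ) (f : SkewLaurent θ)
    (N : (fixedField θ)[X]) :
    sec θ j (f * ofCenter θ N) = sec θ j f * toLaurent θ N := by
  have hr : (orderOf θ : ℤ) ≠ 0 := by exact_mod_cast hθ.orderOf_pos.ne'
  induction N using Polynomial.induction_on' with
  | add p q hp hq => rw [map_add, mul_add, map_add, hp, hq, map_add, mul_add]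
  | monomial k b =>
    induction f using SkewLaurent.induction_on with
    | h0 => simp
    | ha f g hf hg => rw [add_mul, map_add, hf, hg, map_add, add_mul]
    | hm n a =>
      have h1 : toLaurent θ (Polynomial.monomial k b) =
          LaurentPolynomial.C (b : K) * LaurentPolynomial.T k := by
        simp [toLaurent, ← Polynomial.C_mul_X_pow_eq_monomial]
      have h2 : n + orderOf θ * k - j = n - j + orderOf θ * k := by ring
      rw [← (ofCenter_commute θ _ _).eq, ofCenter_monomial, monomial_mul_monomial, zpow_mul,
        zpow_natCast, zpow_natCast, pow_orderOf_eq_one, one_pow, RingAut.one_apply, sec_monomial,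
        sec_monomial, h1, add_comm, h2]
      simp only [Int.dvd_add_left (dvd_mul_right (orderOf θ : ℤ) (k : ℤ))]
      split_ifs with h
      · rw [Int.add_mul_ediv_left _ _ hr, LaurentPolynomial.T_add, map_mul]
        ring
      · simp

/-- The map `𝒜/N𝒜 → 𝒞/N𝒞` induced by `sec_j`. -/
def secQuot (hθ : IsOfFinOrder θ) (j : ℤ) (N : (fixedField θ)[X]) :
    SkewQuot θ N →+ K[T;T⁻¹] ⧸ Ideal.span {toLaurent θ N} :=
  QuotientAddGroup.lift (skewIdeal θ N).toAddSubgroup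
    ((Ideal.Quotient.mk (Ideal.span {toLaurent θ N})).toAddMonoidHom.comp (sec θ j)) (by
      intro f hf
      obtain ⟨g, rfl⟩ := Ideal.mem_span_singleton'.1 hf
      refine Ideal.Quotient.eq_zero_iff_mem.2 ?_
      rw [sec_mul_ofCenter θ hθ]
      exact Ideal.mul_mem_left _ _ (Ideal.mem_span_singleton_self _))

/-! ### Taylor expansions and residues at the points of the separable closure -/

variable {Fs : Type*} [Field Fs] [Algebra (fixedField θ) Fs]

/-- A `z`-admissible morphism, `N` being the minimal polynomial of `z` over `F`: a homomorphism of
`K`-algebras `τ : 𝒜̂_N → (𝒜/N𝒜)[[T]]` with `τ(X) ≡ X mod T` and `τ(Y) = z + T`, where `Y = X^r` and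
`z` stands for the class of `Y` in `𝒜/N𝒜`. -/
structure AdmissibleMorphism (z : Fs) where
  toRingHom : SkewCompletion θ (minpoly (fixedField θ) z) →+*
    PowerSeries (SkewQuot θ (minpoly (fixedField θ) z))
  map_C : ∀ a : K, toRingHom (toCompletion θ _ (SkewLaurent.C θ a)) =
    PowerSeries.C (Ideal.Quotient.mk _ (SkewLaurent.C θ a))
  map_X : PowerSeries.constantCoeff (toRingHom (toCompletion θ _ (SkewLaurent.X θ))) =
    Ideal.Quotient.mk _ (SkewLaurent.X θ)
  map_Y : toRingHom (toCompletion θ _ (SkewLaurent.X θ ^ orderOf θ)) =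
    PowerSeries.C (Ideal.Quotient.mk _ (SkewLaurent.X θ ^ orderOf θ)) + PowerSeries.X

variable {θ} in
/-- The restriction to `𝒜` of an admissible morphism, with values in `(𝒜/N𝒜)((T))`. -/
def AdmissibleMorphism.toLaurentSeries {z : Fs} (τ : AdmissibleMorphism θ z) :
    SkewLaurent θ →+* LaurentSeries (SkewQuot θ (minpoly (fixedField θ) z)) :=
  (HahnSeries.ofPowerSeries ℤ _).comp (τ.toRingHom.comp (toCompletion θ _))

variable {θ} in
theorem AdmissibleMorphism.isUnit [IsSepClosure (fixedField θ) Fs] {z : Fs}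
    (τ : AdmissibleMorphism θ z) (D : (fixedField θ)[X]) (hD : D ≠ 0) :
    IsUnit (τ.toLaurentSeries (ofCenter θ D)) := by
  have : Algebra.IsSeparable (fixedField θ) Fs := IsSepClosure.separable
  set N := minpoly (fixedField θ) z with hN
  have : Fact (Irreducible N) := ⟨minpoly.irreducible (Algebra.IsIntegral.isIntegral z)⟩
  let e : AdjoinRoot N →+* SkewQuot θ N :=
    Ideal.Quotient.lift (Ideal.span {N}) ((Ideal.Quotient.mk _).comp (ofCenter θ)) (by
      intro a ha
      obtain ⟨b, rfl⟩ := Ideal.mem_span_singleton'.1 ha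
      refine Ideal.Quotient.eq_zero_iff_mem.2 ?_
      rw [map_mul]
      exact Ideal.mul_mem_left _ _ (Ideal.mem_span_singleton_self _))
  let ψ : PowerSeries (AdjoinRoot N) →+* LaurentSeries (SkewQuot θ N) :=
    (HahnSeries.ofPowerSeries ℤ _).comp (PowerSeries.map e)
  let ev : (fixedField θ)[X] →+* PowerSeries (AdjoinRoot N) :=
    Polynomial.coeToPowerSeries.ringHom.comp
      ((Polynomial.compRingHom (Polynomial.X + Polynomial.C (AdjoinRoot.root N))).comp
        (Polynomial.mapRingHom (AdjoinRoot.of N)))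
  have h : τ.toLaurentSeries.comp (ofCenter θ) = ψ.comp ev := by
    refine Polynomial.ringHom_ext (fun a => ?_) ?_
    · have h1 : ofCenter θ (Polynomial.C a) = SkewLaurent.C θ (a : K) :=
        Polynomial.eval₂_C _ _
      simp only [RingHom.comp_apply, AdmissibleMorphism.toLaurentSeries, h1, τ.map_C, ψ, ev]
      have h3 : e (AdjoinRoot.of N a) = Ideal.Quotient.mk _ (SkewLaurent.C θ (a : K)) := by
        rw [← h1]; rfl
      congr 1
      simp [h3]
      rfl
    · have h1 : ofCenter θ Polynomial.X = SkewLaurent.X θ ^ orderOf θ :=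
        Polynomial.eval₂_X _ _
      simp only [RingHom.comp_apply, AdmissibleMorphism.toLaurentSeries, h1, τ.map_Y, ψ, ev]
      have h3 : e (AdjoinRoot.root N) = Ideal.Quotient.mk _ (SkewLaurent.X θ ^ orderOf θ) := by
        rw [← h1]; rfl
      congr 1
      simp [h3, add_comm]
      rfl
  have h' := DFunLike.congr_fun h D
  simp only [RingHom.comp_apply] at h'
  rw [h']
  refine isUnit_map_powerSeries ψ ?_ _ ?_
  · simp only [ψ, RingHom.comp_apply, PowerSeries.map_X, HahnSeries.ofPowerSeries_X]
    refine ⟨⟨HahnSeries.single 1 1, HahnSeries.single (-1) 1, ?_, ?_⟩, rfl⟩ <;>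
    · rw [HahnSeries.single_mul_single]
      simp
  · have h2 : Polynomial.taylor (AdjoinRoot.root N) (D.map (AdjoinRoot.of N)) ≠ 0 := by
      rw [Ne, Polynomial.taylor_eq_zero, Polynomial.map_eq_zero]
      exact hD
    intro h0
    apply h2
    rw [Polynomial.taylor_apply]
    simpa [ev] using h0

variable {θ} in
/-- The Taylor expansion `TS_z : Frac(𝒜) → (𝒜/N𝒜)((T))` attached to an admissible morphism. -/
def AdmissibleMorphism.taylor [IsSepClosure (fixedField θ) Fs] {z : Fs}
    (τ : AdmissibleMorphism θ z) :
    SkewFrac θ →+* LaurentSeries (SkewQuot θ (minpoly (fixedField θ) z)) :=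
  fracLift τ.toLaurentSeries τ.isUnit

variable {θ} in
/-- The skew residue `sres_z(f) ∈ 𝒜/N𝒜` at a nonzero point `z`: the coefficient of `T⁻¹`. -/
def AdmissibleMorphism.skewResidue [IsSepClosure (fixedField θ) Fs] {z : Fs}
    (τ : AdmissibleMorphism θ z) (f : SkewFrac θ) : SkewQuot θ (minpoly (fixedField θ) z) :=
  (τ.taylor f).coeff (-1)

/-- The embedding `ι_z : 𝒞/N𝒞 → K ⊗_F F^s`, `a ↦ a ⊗ 1` for `a ∈ K`, `Y ↦ 1 ⊗ z`. -/
def iota (z : Fs) (hz : z ≠ 0) :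
    K[T;T⁻¹] ⧸ Ideal.span {toLaurent θ (minpoly (fixedField θ) z)} →+* K ⊗[fixedField θ] Fs :=
  Ideal.Quotient.lift _
    (LaurentPolynomial.eval₂ (Algebra.TensorProduct.includeLeftRingHom)
      (Units.map ((Algebra.TensorProduct.includeRight :
        Fs →ₐ[fixedField θ] K ⊗[fixedField θ] Fs) : Fs →* K ⊗[fixedField θ] Fs)
        (Units.mk0 z hz))) (by
      intro a ha
      obtain ⟨b, rfl⟩ := Ideal.mem_span_singleton'.1 ha
      rw [map_mul, toLaurent, RingHom.comp_apply, LaurentPolynomial.eval₂_toLaurent,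
        Polynomial.coe_mapRingHom, Polynomial.eval₂_map]
      have h : (Algebra.TensorProduct.includeLeftRingHom :
          K →+* K ⊗[fixedField θ] Fs).comp (fixedField θ).subtype =
          algebraMap (fixedField θ) (K ⊗[fixedField θ] Fs) := rfl
      rw [h, ← Polynomial.aeval_def]
      change _ * Polynomial.aeval ((Algebra.TensorProduct.includeRight :
        Fs →ₐ[fixedField θ] K ⊗[fixedField θ] Fs) z) _ = 0
      rw [Polynomial.aeval_algHom_apply, minpoly.aeval, map_zero, mul_zero])

/-- The `j`-th partial skew residue `sres_{z,j}(f) ∈ K ⊗_F F^s` at `z ∈ F^s ⊔ {∞}`, with respect to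
a choice `τ` of an admissible morphism at each nonzero point of `F^s`. Elements `c` of `K` are viewed
as elements `c ⊗ 1` of `K ⊗_F F^s`. -/
def partialSkewResidue [IsSepClosure (fixedField θ) Fs] (hθ : IsOfFinOrder θ)
    (τ : ∀ z : Fs, z ≠ 0 → AdmissibleMorphism θ z) (j : ℤ) (f : SkewFrac θ) :
    OnePoint Fs → K ⊗[fixedField θ] Fs
  | ∞ => (-SkewLaurentSeries.coeff θ⁻¹ (orderOf θ - j) (taylorInfty θ hθ f)) ⊗ₜ 1
  | (z : Fs) =>
    open Classical in
    if hz : z = 0 then SkewLaurentSeries.coeff θ (j - orderOf θ) (taylorZero θ hθ f) ⊗ₜ 1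
    else iota θ z hz (secQuot θ hθ j _ ((τ z hz).skewResidue f))

/-- All the finite poles of `f` lie in `F^s`: `f = D⁻¹ g` with `g ∈ 𝒜` and `0 ≠ D ∈ F[Y]` a product
of linear factors over `F^s`. -/
def PolesIn (Fs : Type*) [Field Fs] [Algebra (fixedField θ) Fs] (f : SkewFrac θ) : Prop :=
  ∃ D : (fixedField θ)[X], D ≠ 0 ∧ (D.map (algebraMap (fixedField θ) Fs)).Splits ∧
    ∃ g : SkewLaurent θ, toFrac θ (ofCenter θ D) * f = toFrac θ g

/-- The condition on the poles is automatic when `F` is perfect. -/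
theorem polesIn_of_perfectField [PerfectField (fixedField θ)] [IsSepClosure (fixedField θ) Fs]
    (f : SkewFrac θ) : PolesIn θ Fs f := by
  have : IsAlgClosure (fixedField θ) Fs := inferInstance
  have : IsAlgClosed Fs := IsAlgClosure.isAlgClosed (fixedField θ)
  induction f using OreLocalization.ind with
  | _ g s =>
    obtain ⟨_, D, hD, rfl⟩ := s
    refine ⟨D, nonZeroDivisors.ne_zero hD, IsAlgClosed.splits _, g, ?_⟩
    exact OreLocalization.mul_cancel (s := (⟨_, D, hD, rfl⟩ : denominators θ))

end SkewResidue
end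

/-! Let `r` be the order of `θ` and `Y = X^r`. The residues are additive in `f`, and `D⁻¹ g` is the
sum of the `D⁻¹ a Xⁿ` over the monomials of `g`, with the same `D`. So it suffices to treat `f = D⁻¹
a Xⁿ`.

If `r ∣ n`, then `f = a h` with `h ∈ F(Y)`. On `F[Y]` every expansion is prescribed: `Y` becomes `T`
at zero (`T = X^r`), `T⁻¹` at infinity, and `z + T` at a nonzero `z` whatever the admissible
morphism, while elements of `K` stay constant. Hence each partial residue is `a ⊗` the classical
residue of `h`, and the claim is the classical residue formula over `F^s`, where the denominator of
`h` splits (`skewResidueFormula_of_central`). That formula follows from partial fractions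
(`residueFormula_div`).

If `r ∤ n`, some `b ∈ K` has `c = θⁿ(b) ≠ b`, and `f b = c f`. The `0`-th partial residues only see
exponents divisible by `r`, where powers of `X` commute with `K`. They are therefore `K`-linear on
both sides, so each of them is killed by `b - c` and vanishes (`partialSkewResidue_eq_zero`).

For the existence of admissible morphisms, one needs an `r`-th root of `Y + T` that is congruent to
`X` and commutes with `K` as `X` does. For `a ∈ K` and `g` a series with central coefficients, `((1
+ a g) X)^r = P(g) Y` with `P(S) = ∏ (1 + θⁱ(a) S)` (`twistedX_pow`). This `P` has coefficients in
`F` and begins with `1 + Tr(a) S`. For `a` of trace one, which exists in every characteristic, `P(g)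
= 1 + y⁻¹ T` is solved by inverting a power series for composition, `y` being the class of `Y`. The
resulting morphism sends `N` into the multiples of `T`, so it extends to the completion
(`completionLift`). -/

noncomputable section

namespace SkewResidue

section

/-! ### Coefficientwise maps of Laurent series -/

/-- The homomorphism `R((T)) → S((T))` induced by a ring homomorphism `R → S`. -/
def mapSeries {R S : Type*} [Ring R] [Ring S] (σ : R →+* S) :
    LaurentSeries R →+* LaurentSeries S where
  toFun s := HahnSeries.map s σ
  map_zero' := by ext; simp
  map_one' := by
    ext i
    by_cases hi : i = 0 <;> simp [HahnSeries.coeff_one, hi]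
  map_add' s t := by ext; simp
  map_mul' s t := by
    -- Coefficients may die under `σ`, so supports can shrink; the two product sums are compared
    -- over the antidiagonal of the original supports.
    have hs : (HahnSeries.map s σ).support ⊆ s.support := fun i hi h0 => hi (by simp_all)
    have ht : (HahnSeries.map t σ).support ⊆ t.support := fun i hi h0 => hi (by simp_all)
    ext i
    rw [HahnSeries.coeff_mul_left' s.isPWO_support hs,
      Finset.sum_subset (s₁ := Finset.antidiagonal s.isPWO_support
        (HahnSeries.map t σ).isPWO_support i)
        (s₂ := Finset.antidiagonal s.isPWO_support t.isPWO_support i)]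
    · simp [HahnSeries.coeff_mul]
    · intro ij hij
      rw [Finset.mem_antidiagonal] at hij ⊢
      exact ⟨hij.1, ht hij.2.1, hij.2.2⟩
    · intro ij hij hij'
      rw [Finset.mem_antidiagonal] at hij hij'
      have : (HahnSeries.map t σ).coeff ij.2 = 0 := by
        by_contra h
        exact hij' ⟨hij.1, h, hij.2.2⟩
      rw [this, mul_zero]

theorem mapSeries_coeff {R S : Type*} [Ring R] [Ring S] (σ : R →+* S) (s : LaurentSeries R)
    (i : ℤ) : (mapSeries σ s).coeff i = σ (s.coeff i) := rfl

theorem mapSeries_single {R S : Type*} [Ring R] [Ring S] (σ : R →+* S) (i : ℤ) (a : R) :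
    mapSeries σ (HahnSeries.single i a) = HahnSeries.single i (σ a) := by
  ext j
  rw [mapSeries_coeff, HahnSeries.coeff_single, HahnSeries.coeff_single]
  split_ifs <;> simp

/-! ### The residue formula for rational functions -/

section Classical

variable {L : Type*} [Field L]

/-- The expansion `p(z + T)` of a polynomial `p` at a point `z`. -/
def expandAt (z : L) : L[X] →+* LaurentSeries L :=
  (HahnSeries.ofPowerSeries ℤ L).comp
    (Polynomial.coeToPowerSeries.ringHom.comp (Polynomial.taylorAlgHom z : L[X] →+* L[X]))

theorem expandAt_C (z a : L) : expandAt z (Polynomial.C a) = HahnSeries.C a := by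
  simp [expandAt]

theorem expandAt_X (z : L) :
    expandAt z Polynomial.X = HahnSeries.C z + HahnSeries.single 1 1 := by
  simp [expandAt, add_comm]

theorem expandAt_injective (z : L) : Function.Injective (expandAt z) := by
  rw [injective_iff_map_eq_zero]
  intro p hp
  have h1 := (map_eq_zero_iff _ (HahnSeries.ofPowerSeries_injective (Γ := ℤ) (R := L))).1 hp
  simpa using h1

/-- The expansion `p(T⁻¹)` of a polynomial `p` at infinity. -/
def expandInfty (L : Type*) [Field L] : L[X] →+* LaurentSeries L :=
  Polynomial.eval₂RingHom HahnSeries.C (HahnSeries.single (-1) 1)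

theorem expandInfty_monomial (n : ℕ) (a : L) :
    expandInfty L (Polynomial.monomial n a) = HahnSeries.single (-(n : ℤ)) a := by
  simp [expandInfty, HahnSeries.single_pow, HahnSeries.C_apply]

theorem expandInfty_coeff (p : L[X]) (i : ℕ) :
    (expandInfty L p).coeff (-(i : ℤ)) = p.coeff i := by
  induction p using Polynomial.induction_on' with
  | add p q hp hq => simp [hp, hq]
  | monomial n a =>
    rw [expandInfty_monomial, HahnSeries.coeff_single, Polynomial.coeff_monomial]
    simp [eq_comm]

theorem expandInfty_coeff_of_pos (p : L[X]) (i : ℤ) (hi : 0 < i) :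
    (expandInfty L p).coeff i = 0 := by
  induction p using Polynomial.induction_on' with
  | add p q hp hq => simp [hp, hq]
  | monomial n a =>
    rw [expandInfty_monomial, HahnSeries.coeff_single, if_neg (by omega)]

theorem expandInfty_injective : Function.Injective (expandInfty L) := by
  intro p q h
  ext i
  rw [← expandInfty_coeff, h, expandInfty_coeff]

/-- The expansion of a rational function at a point. -/
def ratExpandAt (z : L) : RatFunc L →+* LaurentSeries L :=
  IsFractionRing.lift (expandAt_injective z)

/-- The expansion of a rational function at infinity. -/
def ratExpandInfty (L : Type*) [Field L] : RatFunc L →+* LaurentSeries L :=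
  IsFractionRing.lift (expandInfty_injective (L := L))

theorem ratExpandAt_algebraMap (z : L) (p : L[X]) :
    ratExpandAt z (algebraMap L[X] (RatFunc L) p) = expandAt z p :=
  IsFractionRing.lift_algebraMap _ _

theorem ratExpandInfty_algebraMap (p : L[X]) :
    ratExpandInfty L (algebraMap L[X] (RatFunc L) p) = expandInfty L p :=
  IsFractionRing.lift_algebraMap _ _

/-- The residue of a rational function at a point. -/
def residueAt (z : L) (h : RatFunc L) : L := (ratExpandAt z h).coeff (-1)

/-- The opposite of the residue of a rational function at infinity. -/
def negResidueInfty (h : RatFunc L) : L := (ratExpandInfty L h).coeff 1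

/-- `h` has finitely many nonzero residues, and their sum (infinity included) is zero. -/
def ResidueFormula (h : RatFunc L) : Prop :=
  (Function.support fun z => residueAt z h).Finite ∧ ∑ᶠ z, residueAt z h = negResidueInfty h

theorem ResidueFormula.add {g h : RatFunc L} (hg : ResidueFormula g) (hh : ResidueFormula h) :
    ResidueFormula (g + h) := by
  have e : (fun z => residueAt z (g + h)) = fun z => residueAt z g + residueAt z h := by
    funext z; simp [residueAt]
  rw [ResidueFormula, e]
  refine ⟨(hg.1.union hh.1).subset (Function.support_add _ _), ?_⟩
  rw [finsum_add_distrib hg.1 hh.1, hg.2, hh.2]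
  simp [negResidueInfty]

theorem ResidueFormula.C_mul (c : L) {h : RatFunc L} (hh : ResidueFormula h) :
    ResidueFormula (algebraMap L[X] (RatFunc L) (Polynomial.C c) * h) := by
  have e : (fun z => residueAt z (algebraMap L[X] (RatFunc L) (Polynomial.C c) * h)) =
      fun z => c * residueAt z h := by
    funext z
    simp only [residueAt, map_mul, ratExpandAt_algebraMap, expandAt_C, HahnSeries.C_mul_eq_smul]
    rfl
  rw [ResidueFormula, e]
  refine ⟨hh.1.subset (Function.support_mul_subset_right _ _), ?_⟩
  rw [← mul_finsum' (fun z => residueAt z h) c hh.1, hh.2, negResidueInfty, negResidueInfty, map_mul,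
    ratExpandInfty_algebraMap, ← Polynomial.monomial_zero_left, expandInfty_monomial]
  simp

theorem ofPowerSeries_coeff_neg_one (s : PowerSeries L) :
    (HahnSeries.ofPowerSeries ℤ L s).coeff (-1) = 0 := by
  rw [HahnSeries.ofPowerSeries_apply]
  refine HahnSeries.embDomain_of_notMem_range ?_
  rintro ⟨m, hm⟩
  have : (m : ℤ) = -1 := hm
  omega

theorem residueFormula_algebraMap (p : L[X]) : ResidueFormula (algebraMap L[X] (RatFunc L) p) := by
  have e : (fun z => residueAt z (algebraMap L[X] (RatFunc L) p)) = fun _ => 0 := by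
    funext z
    rw [residueAt, ratExpandAt_algebraMap]
    exact ofPowerSeries_coeff_neg_one _
  rw [ResidueFormula, e, negResidueInfty, ratExpandInfty_algebraMap,
    expandInfty_coeff_of_pos _ _ one_pos]
  simp

/-- The only finite pole is `z`, where the expansion is `T^{-(n+1)}`; elsewhere `X - z` is an
invertible power series. At infinity `X - z = T⁻¹ (1 - z T)`, so the expansion is `T^{n+1} (1 - z
T)^{-(n+1)}`. Both relevant coefficients are `1` for `n = 0` and `0` otherwise. -/
theorem residueFormula_inv_pow (z : L) (n : ℕ) :
    ResidueFormula
      ((algebraMap L[X] (RatFunc L) (Polynomial.X - Polynomial.C z))⁻¹ ^ (n + 1)) := by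
  have h1 : ∀ w, w ≠ z → residueAt w
      ((algebraMap L[X] (RatFunc L) (Polynomial.X - Polynomial.C z))⁻¹ ^ (n + 1)) = 0 := by
    intro w hw
    have h2 : ratExpandAt w (algebraMap L[X] (RatFunc L) (Polynomial.X - Polynomial.C z))⁻¹ =
        HahnSeries.ofPowerSeries ℤ L (PowerSeries.X + PowerSeries.C (w - z))⁻¹ := by
      rw [map_inv₀, ratExpandAt_algebraMap, map_sub, expandAt_X, expandAt_C]
      refine inv_eq_of_mul_eq_one_right ?_
      have h3 : HahnSeries.C w + HahnSeries.single 1 1 - HahnSeries.C z =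
          HahnSeries.ofPowerSeries ℤ L (PowerSeries.X + PowerSeries.C (w - z)) := by
        rw [map_add, HahnSeries.ofPowerSeries_X, HahnSeries.ofPowerSeries_C, map_sub]
        ring
      rw [h3, ← map_mul, PowerSeries.mul_inv_cancel _ (by simpa using sub_ne_zero.2 hw), map_one]
    rw [residueAt, map_pow, h2, ← map_pow]
    exact ofPowerSeries_coeff_neg_one _
  have h2 : ratExpandAt z (algebraMap L[X] (RatFunc L) (Polynomial.X - Polynomial.C z))⁻¹ =
      HahnSeries.single (-1) 1 := by
    rw [map_inv₀, ratExpandAt_algebraMap, map_sub, expandAt_X, expandAt_C, add_sub_cancel_left]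
    refine inv_eq_of_mul_eq_one_right ?_
    simp
  have h3 : ratExpandInfty L (algebraMap L[X] (RatFunc L) (Polynomial.X - Polynomial.C z))⁻¹ =
      HahnSeries.ofPowerSeries ℤ L
        (PowerSeries.X * (1 - PowerSeries.C z * PowerSeries.X)⁻¹) := by
    rw [map_inv₀, ratExpandInfty_algebraMap, map_sub, ← Polynomial.monomial_zero_left,
      expandInfty_monomial, ← Polynomial.monomial_one_one_eq_X, expandInfty_monomial]
    refine inv_eq_of_mul_eq_one_right ?_
    have h4 : HahnSeries.single (-((1 : ℕ) : ℤ)) (1 : L) - HahnSeries.single (-((0 : ℕ) : ℤ)) z =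
        HahnSeries.single (-1) 1 * HahnSeries.ofPowerSeries ℤ L
          (1 - PowerSeries.C z * PowerSeries.X) := by
      rw [map_sub, map_one (HahnSeries.ofPowerSeries ℤ L), map_mul, HahnSeries.ofPowerSeries_X,
        HahnSeries.ofPowerSeries_C,
        HahnSeries.C_apply, mul_sub, mul_one, HahnSeries.single_mul_single,
        HahnSeries.single_mul_single]
      simp
    rw [h4, mul_assoc, ← map_mul, mul_left_comm, PowerSeries.mul_inv_cancel _ (by simp), mul_one,
      HahnSeries.ofPowerSeries_X]
    simp
  have e : ∀ w, residueAt w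
      ((algebraMap L[X] (RatFunc L) (Polynomial.X - Polynomial.C z))⁻¹ ^ (n + 1)) ≠ 0 → w = z :=
    fun w hw => by_contra fun h => hw (h1 w h)
  refine ⟨(Set.finite_singleton z).subset e, ?_⟩
  rw [finsum_eq_single _ z h1, residueAt, negResidueInfty, map_pow, map_pow, h2, h3,
    ← map_pow (HahnSeries.ofPowerSeries ℤ L), HahnSeries.single_pow, HahnSeries.coeff_single, mul_pow]
  have h5 : (HahnSeries.ofPowerSeries ℤ L (PowerSeries.X ^ (n + 1) *
      (1 - PowerSeries.C z * PowerSeries.X)⁻¹ ^ (n + 1))).coeff ((1 : ℕ) : ℤ) =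
      if n = 0 then 1 else 0 := by
    rw [HahnSeries.ofPowerSeries_apply_coeff, PowerSeries.coeff_X_pow_mul']
    rcases Nat.eq_zero_or_pos n with rfl | hn
    · simp
    · rw [if_neg (by omega), if_neg (by omega)]
  rw [Nat.cast_one] at h5
  rw [h5]
  rcases Nat.eq_zero_or_pos n with rfl | hn
  · simp
  · rw [if_neg (by simp; omega), if_neg hn.ne']

/-- Writing `p = p(z) + (X - z) p₁` splits off a pure inverse power and lowers the order of the pole
of the rest. -/
theorem residueFormula_div_pow (z : L) (n : ℕ) (p : L[X]) :
    ResidueFormula (algebraMap L[X] (RatFunc L) p *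
      (algebraMap L[X] (RatFunc L) (Polynomial.X - Polynomial.C z))⁻¹ ^ n) := by
  induction n generalizing p with
  | zero => simpa using residueFormula_algebraMap p
  | succ n ih =>
    have h0 : algebraMap L[X] (RatFunc L) (Polynomial.X - Polynomial.C z) ≠ 0 :=
      (map_ne_zero_iff _ (IsFractionRing.injective L[X] (RatFunc L))).2
        (Polynomial.X_sub_C_ne_zero z)
    have h1 := Polynomial.modByMonic_add_div p (Polynomial.X - Polynomial.C z)
    rw [Polynomial.modByMonic_X_sub_C_eq_C_eval] at h1
    have h2 := ((residueFormula_inv_pow z n).C_mul (p.eval z)).add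
      (ih (p /ₘ (Polynomial.X - Polynomial.C z)))
    convert h2 using 1
    conv_lhs => rw [← h1, map_add, map_mul, add_mul, pow_succ]
    rw [pow_succ]
    field_simp

/-- The residue formula for rational functions all of whose poles are rational. -/
theorem residueFormula_div (p q : L[X]) (hq : q.Splits) :
    ResidueFormula (algebraMap L[X] (RatFunc L) p / algebraMap L[X] (RatFunc L) q) := by
  have key : ∀ (n : ℕ) (s : Multiset L), s.card = n → ∀ p : L[X],
      ResidueFormula (algebraMap L[X] (RatFunc L) p *
        (s.map fun z => (algebraMap L[X] (RatFunc L) (Polynomial.X - Polynomial.C z))⁻¹).prod) := by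
    intro n
    induction n using Nat.strong_induction_on with
    | _ n ih =>
      intro s hs p
      -- With two distinct poles, `1/((X-z)(X-w)) = (z-w)⁻¹ (1/(X-z) - 1/(X-w))` reduces to
      -- fractions with one factor fewer. Otherwise the denominator is a power of a single linear
      -- factor.
      by_cases hd : ∃ z ∈ s, ∃ w ∈ s, w ≠ z
      · obtain ⟨z, hz, w, hw, hwz⟩ := hd
        obtain ⟨t, rfl⟩ := Multiset.exists_cons_of_mem hz
        obtain ⟨u, rfl⟩ := Multiset.exists_cons_of_mem
          ((Multiset.mem_cons.1 hw).resolve_left hwz)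
        simp only [Multiset.card_cons] at hs
        have h1 := ih (u.card + 1) (by omega) (z ::ₘ u) (by simp) p
        have h2 := ih (u.card + 1) (by omega) (w ::ₘ u) (by simp) p
        have h3 := (h1.C_mul (z - w)⁻¹).add (h2.C_mul (-(z - w)⁻¹))
        convert h3 using 1
        have h0 : ∀ z : L, algebraMap L[X] (RatFunc L) (Polynomial.X - Polynomial.C z) ≠ 0 :=
          fun z => (map_ne_zero_iff _ (IsFractionRing.injective L[X] (RatFunc L))).2
            (Polynomial.X_sub_C_ne_zero z)
        have h4 : algebraMap L[X] (RatFunc L) (Polynomial.C (z - w)⁻¹) *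
            (algebraMap L[X] (RatFunc L) (Polynomial.X - Polynomial.C w) -
              algebraMap L[X] (RatFunc L) (Polynomial.X - Polynomial.C z)) = 1 := by
          rw [← map_sub, sub_sub_sub_cancel_left, ← Polynomial.C_sub, ← map_mul,
            ← Polynomial.C_mul, inv_mul_cancel₀ (sub_ne_zero.2 hwz.symm), Polynomial.C_1, map_one]
        simp only [Multiset.map_cons, Multiset.prod_cons]
        rw [Polynomial.C_neg, map_neg]
        have hz0 := h0 z
        have hw0 := h0 w
        generalize algebraMap L[X] (RatFunc L) (Polynomial.X - Polynomial.C z) = a at *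
        generalize algebraMap L[X] (RatFunc L) (Polynomial.X - Polynomial.C w) = b at *
        generalize algebraMap L[X] (RatFunc L) (Polynomial.C (z - w)⁻¹) = c at *
        generalize (u.map fun z =>
          (algebraMap L[X] (RatFunc L) (Polynomial.X - Polynomial.C z))⁻¹).prod = d
        field_simp
        linear_combination (-(algebraMap L[X] (RatFunc L) p * d)) * h4
      · push Not at hd
        rcases s.empty_or_exists_mem with rfl | ⟨z, hz⟩
        · simpa using residueFormula_algebraMap p
        · rw [Multiset.eq_replicate_card.2 (hd z hz), Multiset.map_replicate,
            Multiset.prod_replicate]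
          exact residueFormula_div_pow z _ p
  have h1 := (key _ q.roots rfl p).C_mul q.leadingCoeff⁻¹
  convert h1 using 1
  conv_lhs => rw [hq.eq_prod_roots]
  rw [div_eq_mul_inv, map_mul, mul_inv, map_multiset_prod, Multiset.map_map,
    ← Multiset.prod_map_inv]
  have h2 : (algebraMap L[X] (RatFunc L) (Polynomial.C q.leadingCoeff))⁻¹ =
      algebraMap L[X] (RatFunc L) (Polynomial.C q.leadingCoeff⁻¹) :=
    (map_inv₀ ((algebraMap L[X] (RatFunc L)).comp Polynomial.C) _).symm
  rw [h2, mul_left_comm]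
  rfl

end Classical

end

section

/-! ### Expansions under extension of the coefficient field -/

section Expansions

theorem mapSeries_expandAt {E L : Type*} [Field E] [Field L] (σ : E →+* L) (z : E) (p : E[X]) :
    mapSeries σ (expandAt z p) = expandAt (σ z) (p.map σ) := by
  have h : (mapSeries σ).comp (expandAt z) =
      (expandAt (σ z)).comp (Polynomial.mapRingHom σ) := by
    refine Polynomial.ringHom_ext (fun a => ?_) ?_
    · simp only [RingHom.comp_apply, Polynomial.coe_mapRingHom, Polynomial.map_C, expandAt_C]
      exact mapSeries_single _ _ _
    · simp only [RingHom.comp_apply, Polynomial.coe_mapRingHom, Polynomial.map_X, expandAt_X,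
        HahnSeries.C_apply, map_add, mapSeries_single, map_one]
  exact DFunLike.congr_fun h p

theorem expandAt_comp_map_injective {E L : Type*} [Field E] [Field L] (σ : E →+* L) (z : L) :
    Function.Injective ((expandAt z).comp (Polynomial.mapRingHom σ)) :=
  (expandAt_injective z).comp (Polynomial.map_injective σ σ.injective)

theorem mapSeries_expandInfty {E L : Type*} [Field E] [Field L] (σ : E →+* L) (p : E[X]) :
    mapSeries σ (expandInfty E p) = expandInfty L (p.map σ) := by
  induction p using Polynomial.induction_on' with
  | add p q hp hq => rw [map_add, map_add, hp, hq, Polynomial.map_add, map_add]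
  | monomial n a =>
    rw [expandInfty_monomial, mapSeries_single, Polynomial.map_monomial, expandInfty_monomial]

/-- Used for `F → F^s` at zero, and for `F[Y]/N → F^s` to carry a residue at the class of `Y` to a
residue at `z`. -/
theorem map_residueAt {E L : Type*} [Field E] [Field L] (σ : E →+* L) (z : E) (p q : E[X]) :
    σ ((expandAt z p / expandAt z q).coeff (-1)) = residueAt (σ z)
      (algebraMap L[X] (RatFunc L) (p.map σ) / algebraMap L[X] (RatFunc L) (q.map σ)) := by
  rw [← mapSeries_coeff, map_div₀, mapSeries_expandAt, mapSeries_expandAt, residueAt, map_div₀,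
    ratExpandAt_algebraMap, ratExpandAt_algebraMap]

theorem map_negResidueInfty {E L : Type*} [Field E] [Field L] (σ : E →+* L) (p q : E[X]) :
    σ ((expandInfty E p / expandInfty E q).coeff 1) = negResidueInfty
      (algebraMap L[X] (RatFunc L) (p.map σ) / algebraMap L[X] (RatFunc L) (q.map σ)) := by
  rw [← mapSeries_coeff, map_div₀, mapSeries_expandInfty, mapSeries_expandInfty, negResidueInfty,
    map_div₀, ratExpandInfty_algebraMap, ratExpandInfty_algebraMap]

end Expansions

/-! ### Expansions of a constant times a central fraction -/

variable {K : Type*} [Field K] (θ : RingAut K)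

theorem isUnit_toFrac_ofCenter (D : (fixedField θ)[X]) (hD : D ≠ 0) :
    IsUnit (toFrac θ (ofCenter θ D)) :=
  OreLocalization.numerator_isUnit
    (⟨_, D, mem_nonZeroDivisors_of_ne_zero hD, rfl⟩ : denominators θ)

variable {θ} in
/-- An expansion of `q⁻¹ a p`, when the center is expanded in Laurent series over a field. -/
theorem map_eq_mul_map_div {E B : Type*} [Field E] [Ring B] (φ : SkewFrac θ →+* B)
    (ψ : LaurentSeries E →+* B) (x : (fixedField θ)[X] →+* LaurentSeries E)
    (hx : Function.Injective x) (h : ∀ p, φ (toFrac θ (ofCenter θ p)) = ψ (x p))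
    {p q : (fixedField θ)[X]} (hq : q ≠ 0) {a : K} {f : SkewFrac θ}
    (hf : toFrac θ (ofCenter θ q) * f = toFrac θ (SkewLaurent.C θ a * ofCenter θ p)) :
    φ f = φ (toFrac θ (SkewLaurent.C θ a)) * ψ (x p / x q) := by
  have hxq : x q ≠ 0 := (map_ne_zero_iff x hx).2 hq
  -- After multiplication by the unit `φ(q)`, which moves past `a` because `q` is central, both
  -- sides equal `φ(a p)`.
  refine ((isUnit_toFrac_ofCenter θ q hq).map φ).mul_left_cancel ?_
  rw [← map_mul, hf, ← mul_assoc, ← map_mul, ← map_mul, (ofCenter_commute θ q _).eq, map_mul,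
    map_mul, map_mul, map_mul, h, h, mul_assoc, ← map_mul, mul_div_cancel₀ _ hxq]

/-! ### Expansions at zero and infinity -/

/-- The homomorphism `F((T)) → K((X; θ))`, `T ↦ X^n`, with values in the ambient ring. -/
def centerSeries (F : Subfield K) (n : ℕ) (hn : 0 < n) :
    LaurentSeries F →+* LaurentSeries (Module.End ℤ K) :=
  (HahnSeries.embDomainRingHom (AddMonoidHom.mulLeft (n : ℤ))
    (fun a b h => by simpa [hn.ne'] using h) (fun a b => by simp [hn])).comp
    (mapSeries (mulEnd.comp F.subtype))

theorem centerSeries_coeff (F : Subfield K) (n : ℕ) (hn : 0 < n) (s : LaurentSeries F) (i : ℤ) :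
    (centerSeries F n hn s).coeff (n * i) = mulEnd (s.coeff i : K) :=
  HahnSeries.embDomain_coeff (a := i)

theorem centerSeries_single (F : Subfield K) (n : ℕ) (hn : 0 < n) (i : ℤ) (a : F) :
    centerSeries F n hn (HahnSeries.single i a) = HahnSeries.single (n * i) (mulEnd (a : K)) := by
  change HahnSeries.embDomain _ (mapSeries (mulEnd.comp F.subtype) (HahnSeries.single i a)) = _
  rw [mapSeries_single, HahnSeries.embDomain_single]
  rfl

theorem expandAt_zero_monomial {L : Type*} [Field L] (n : ℕ) (a : L) :
    expandAt 0 (Polynomial.monomial n a) = HahnSeries.single (n : ℤ) a := by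
  rw [← Polynomial.C_mul_X_pow_eq_monomial, map_mul, map_pow, expandAt_C, expandAt_X, map_zero,
    zero_add, HahnSeries.single_pow, HahnSeries.C_apply, HahnSeries.single_mul_single]
  simp

/-- Only exponents that are multiples of the order of `θ` occur, so the twists `θⁱ` are trivial and
the series is a commutative one in `T = X^r`. -/
theorem toSeriesAux_ofCenter (hθ : IsOfFinOrder θ) (p : (fixedField θ)[X]) :
    toSeriesAux θ (ofCenter θ p) =
      centerSeries (fixedField θ) (orderOf θ) hθ.orderOf_pos (expandAt 0 p) := by
  induction p using Polynomial.induction_on' with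
  | add p q hp hq => rw [map_add, map_add, hp, hq, map_add, map_add]
  | monomial n a =>
    rw [ofCenter_monomial, toSeriesAux_monomial, expandAt_zero_monomial, centerSeries_single,
      zpow_mul, zpow_natCast, zpow_natCast, pow_orderOf_eq_one, one_pow, map_one, mul_one]

theorem toSeriesAux_invertX_ofCenter (hθ : IsOfFinOrder θ) (p : (fixedField θ)[X]) :
    toSeriesAux θ⁻¹ (invertX θ (ofCenter θ p)) =
      centerSeries (fixedField θ) (orderOf θ) hθ.orderOf_pos (expandInfty _ p) := by
  induction p using Polynomial.induction_on' with
  | add p q hp hq => rw [map_add, map_add, map_add, hp, hq, map_add, map_add]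
  | monomial n a =>
    rw [ofCenter_monomial, invertX_monomial, toSeriesAux_monomial, expandInfty_monomial,
      centerSeries_single, inv_zpow', neg_neg, zpow_mul, zpow_natCast, zpow_natCast,
      pow_orderOf_eq_one, one_pow, map_one, mul_one, mul_neg]

variable {θ}

/-- The case `i = -1` is the residue at zero: the coefficient of `X^{-r}` is a classical coefficient
of `T⁻¹`. -/
theorem taylorZero_coeff (hθ : IsOfFinOrder θ) {p q : (fixedField θ)[X]} (hq : q ≠ 0) {a : K}
    {f : SkewFrac θ}
    (hf : toFrac θ (ofCenter θ q) * f = toFrac θ (SkewLaurent.C θ a * ofCenter θ p)) (i : ℤ) :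
    SkewLaurentSeries.coeff θ (orderOf θ * i) (taylorZero θ hθ f) =
      a * ((expandAt 0 p / expandAt 0 q).coeff i : fixedField θ) := by
  have h := map_eq_mul_map_div ((SkewLaurentSeries θ).subtype.comp (taylorZero θ hθ))
    (centerSeries (fixedField θ) (orderOf θ) hθ.orderOf_pos) (expandAt 0) (expandAt_injective 0)
    (fun p => by
      rw [← toSeriesAux_ofCenter θ hθ, RingHom.comp_apply, taylorZero, fracLift_toFrac]
      rfl) hq hf
  have h1 : ((SkewLaurentSeries θ).subtype.comp (taylorZero θ hθ))
      (toFrac θ (SkewLaurent.C θ a)) = HahnSeries.single 0 (mulEnd a) := by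
    rw [RingHom.comp_apply, taylorZero, fracLift_toFrac]
    exact (toSeriesAux_monomial θ 0 a).trans (by simp)
  rw [h1] at h
  change HahnSeries.coeff (((SkewLaurentSeries θ).subtype.comp (taylorZero θ hθ)) f) _ 1 = _
  rw [h, HahnSeries.coeff_single_zero_mul, centerSeries_coeff]
  exact congrArg (a * ·) (mul_one _)

/-- The case `i = 1` is the residue at infinity up to sign, in the variable `T = Y⁻¹`. -/
theorem taylorInfty_coeff (hθ : IsOfFinOrder θ) {p q : (fixedField θ)[X]} (hq : q ≠ 0) {a : K}
    {f : SkewFrac θ}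
    (hf : toFrac θ (ofCenter θ q) * f = toFrac θ (SkewLaurent.C θ a * ofCenter θ p)) (i : ℤ) :
    SkewLaurentSeries.coeff θ⁻¹ (orderOf θ * i) (taylorInfty θ hθ f) =
      a * ((expandInfty _ p / expandInfty _ q).coeff i : fixedField θ) := by
  have h := map_eq_mul_map_div ((SkewLaurentSeries θ⁻¹).subtype.comp (taylorInfty θ hθ))
    (centerSeries (fixedField θ) (orderOf θ) hθ.orderOf_pos) (expandInfty _) expandInfty_injective
    (fun p => by
      rw [← toSeriesAux_invertX_ofCenter θ hθ, RingHom.comp_apply, taylorInfty, fracLift_toFrac]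
      rfl) hq hf
  have h1 : ((SkewLaurentSeries θ⁻¹).subtype.comp (taylorInfty θ hθ))
      (toFrac θ (SkewLaurent.C θ a)) = HahnSeries.single 0 (mulEnd a) := by
    rw [RingHom.comp_apply, taylorInfty, fracLift_toFrac]
    change toSeriesAux θ⁻¹ (invertX θ (SkewLaurent.monomial θ 0 a)) = _
    rw [invertX_monomial]
    exact (toSeriesAux_monomial θ⁻¹ _ a).trans (by simp)
  rw [h1] at h
  change HahnSeries.coeff (((SkewLaurentSeries θ⁻¹).subtype.comp (taylorInfty θ hθ)) f) _ 1 = _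
  rw [h, HahnSeries.coeff_single_zero_mul, centerSeries_coeff]
  exact congrArg (a * ·) (mul_one _)

/-! ### Expansions at nonzero points -/

variable (θ) in
/-- The homomorphism `F[Y]/N → 𝒜/N𝒜`. -/
def centerQuot (N : (fixedField θ)[X]) : AdjoinRoot N →+* SkewQuot θ N :=
  Ideal.Quotient.lift (Ideal.span {N})
    ((Ideal.Quotient.mk (skewIdeal θ N)).comp (ofCenter θ)) (by
      intro a ha
      obtain ⟨b, rfl⟩ := Ideal.mem_span_singleton'.1 ha
      refine Ideal.Quotient.eq_zero_iff_mem.2 ?_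
      rw [map_mul]
      exact Ideal.mul_mem_left _ _ (Ideal.mem_span_singleton_self _))

theorem centerQuot_mk (N p : (fixedField θ)[X]) :
    centerQuot θ N (AdjoinRoot.mk N p) = Ideal.Quotient.mk _ (ofCenter θ p) := rfl

theorem ofCenter_C (a : fixedField θ) :
    ofCenter θ (Polynomial.C a) = SkewLaurent.C θ (a : K) :=
  Polynomial.eval₂_C _ _

theorem ofCenter_X : ofCenter θ Polynomial.X = SkewLaurent.X θ ^ orderOf θ :=
  Polynomial.eval₂_X _ _

theorem centerQuot_of (N : (fixedField θ)[X]) (a : fixedField θ) :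
    centerQuot θ N (AdjoinRoot.of N a) = Ideal.Quotient.mk _ (SkewLaurent.C θ (a : K)) := by
  rw [← ofCenter_C]; rfl

theorem centerQuot_root (N : (fixedField θ)[X]) :
    centerQuot θ N (AdjoinRoot.root N) = Ideal.Quotient.mk _ (SkewLaurent.X θ ^ orderOf θ) := by
  rw [← ofCenter_X]; rfl

variable {Fs : Type*} [Field Fs] [Algebra (fixedField θ) Fs]

/-- On `F[Y]` an admissible morphism is determined by its values on constants and on `Y`, both
imposed. This is why central fractions have residues independent of `τ`. -/
theorem AdmissibleMorphism.toLaurentSeries_ofCenter {z : Fs} (τ : AdmissibleMorphism θ z)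
    [Fact (Irreducible (minpoly (fixedField θ) z))] (p : (fixedField θ)[X]) :
    τ.toLaurentSeries (ofCenter θ p) = mapSeries (centerQuot θ _)
      (expandAt (AdjoinRoot.root (minpoly (fixedField θ) z)) (p.map (AdjoinRoot.of _))) := by
  have h : τ.toLaurentSeries.comp (ofCenter θ) = (mapSeries (centerQuot θ _)).comp
      ((expandAt (AdjoinRoot.root (minpoly (fixedField θ) z))).comp
        (Polynomial.mapRingHom (AdjoinRoot.of _))) := by
    refine Polynomial.ringHom_ext (fun a => ?_) ?_
    · simp only [RingHom.comp_apply, ofCenter_C, Polynomial.coe_mapRingHom, Polynomial.map_C,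
        expandAt_C, HahnSeries.C_apply, mapSeries_single, centerQuot_of]
      rw [AdmissibleMorphism.toLaurentSeries, RingHom.comp_apply, RingHom.comp_apply, τ.map_C,
        HahnSeries.ofPowerSeries_C]
      rfl
    · simp only [RingHom.comp_apply, ofCenter_X, Polynomial.coe_mapRingHom, Polynomial.map_X,
        expandAt_X, HahnSeries.C_apply, map_add, mapSeries_single, centerQuot_root, map_one]
      rw [AdmissibleMorphism.toLaurentSeries, RingHom.comp_apply, RingHom.comp_apply, τ.map_Y,
        map_add, HahnSeries.ofPowerSeries_C, HahnSeries.ofPowerSeries_X]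
      rfl
  exact DFunLike.congr_fun h p

/-- The embedding `F[Y]/N → F^s`, `Y ↦ z`, where `N` is the minimal polynomial of `z`. -/
def evalRoot (z : Fs) : AdjoinRoot (minpoly (fixedField θ) z) →+* Fs :=
  AdjoinRoot.lift (algebraMap (fixedField θ) Fs) z
    ((Polynomial.aeval_def z _).symm.trans (minpoly.aeval _ _))

theorem evalRoot_mk (z : Fs) (p : (fixedField θ)[X]) :
    evalRoot z (AdjoinRoot.mk _ p) = Polynomial.aeval z p := AdjoinRoot.lift_mk _ _

theorem evalRoot_root (z : Fs) :
    evalRoot z (AdjoinRoot.root (minpoly (fixedField θ) z)) = z := AdjoinRoot.lift_root _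

theorem evalRoot_comp_of (z : Fs) :
    (evalRoot z).comp (AdjoinRoot.of (minpoly (fixedField θ) z)) =
      algebraMap (fixedField θ) Fs := AdjoinRoot.lift_comp_of _

/-- The operator `sec₀` is linear over `F[Y]`, so it leaves `a p(Y)` unchanged; `ι_z` then evaluates
at `Y = z`. -/
theorem iota_secQuot (hθ : IsOfFinOrder θ) (z : Fs) (hz : z ≠ 0) (a : K)
    (u : AdjoinRoot (minpoly (fixedField θ) z)) :
    iota θ z hz (secQuot θ hθ 0 _ (Ideal.Quotient.mk _ (SkewLaurent.C θ a) * centerQuot θ _ u)) =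
      a ⊗ₜ evalRoot z u := by
  induction u using AdjoinRoot.induction_on with
  | ih p =>
    rw [centerQuot_mk, ← map_mul, evalRoot_mk]
    change iota θ z hz (Ideal.Quotient.mk _ (sec θ 0 (SkewLaurent.C θ a * ofCenter θ p))) = _
    rw [sec_mul_ofCenter θ hθ, map_mul, map_mul]
    have h1 : sec θ 0 (SkewLaurent.C θ a) = LaurentPolynomial.C a := by
      refine (sec_monomial θ 0 0 a).trans ?_
      simp
    rw [h1, iota, Ideal.Quotient.lift_mk, Ideal.Quotient.lift_mk, LaurentPolynomial.eval₂_C,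
      toLaurent, RingHom.comp_apply, LaurentPolynomial.eval₂_toLaurent,
      Polynomial.coe_mapRingHom, Polynomial.eval₂_map]
    have h : (Algebra.TensorProduct.includeLeftRingHom :
        K →+* K ⊗[fixedField θ] Fs).comp (fixedField θ).subtype =
        algebraMap (fixedField θ) (K ⊗[fixedField θ] Fs) := rfl
    rw [h, ← Polynomial.aeval_def]
    change _ * Polynomial.aeval ((Algebra.TensorProduct.includeRight :
      Fs →ₐ[fixedField θ] K ⊗[fixedField θ] Fs) z) _ = _
    rw [Polynomial.aeval_algHom_apply]
    simp

/-- The residue is first computed over the field `F[Y]/N`, as `a` times a central element, and then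
sent to `F^s` by `Y ↦ z`. -/
theorem iota_secQuot_skewResidue [IsSepClosure (fixedField θ) Fs] (hθ : IsOfFinOrder θ) {z : Fs}
    (hz : z ≠ 0) (τ : AdmissibleMorphism θ z)
    {p q : (fixedField θ)[X]} (hq : q ≠ 0) {a : K} {f : SkewFrac θ}
    (hf : toFrac θ (ofCenter θ q) * f = toFrac θ (SkewLaurent.C θ a * ofCenter θ p)) :
    iota θ z hz (secQuot θ hθ 0 _ (τ.skewResidue f)) =
      a ⊗ₜ residueAt z
        (algebraMap Fs[X] (RatFunc Fs) (p.map (algebraMap (fixedField θ) Fs)) /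
          algebraMap Fs[X] (RatFunc Fs) (q.map (algebraMap (fixedField θ) Fs))) := by
  have : Algebra.IsSeparable (fixedField θ) Fs := IsSepClosure.separable
  have : Fact (Irreducible (minpoly (fixedField θ) z)) :=
    ⟨minpoly.irreducible (Algebra.IsIntegral.isIntegral z)⟩
  have h := map_eq_mul_map_div τ.taylor (mapSeries (centerQuot θ _))
    ((expandAt (AdjoinRoot.root (minpoly (fixedField θ) z))).comp
      (Polynomial.mapRingHom (AdjoinRoot.of _)))
    (expandAt_comp_map_injective _ _)
    (fun p => by
      rw [AdmissibleMorphism.taylor, fracLift_toFrac, τ.toLaurentSeries_ofCenter]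
      rfl) hq hf
  have h1 : τ.taylor (toFrac θ (SkewLaurent.C θ a)) =
      HahnSeries.single 0 (Ideal.Quotient.mk _ (SkewLaurent.C θ a)) := by
    rw [AdmissibleMorphism.taylor, fracLift_toFrac, AdmissibleMorphism.toLaurentSeries,
      RingHom.comp_apply, RingHom.comp_apply, τ.map_C, HahnSeries.ofPowerSeries_C]
    rfl
  rw [AdmissibleMorphism.skewResidue, h, h1, HahnSeries.coeff_single_zero_mul, mapSeries_coeff,
    iota_secQuot]
  simp only [RingHom.comp_apply, Polynomial.coe_mapRingHom]
  rw [map_residueAt, Polynomial.map_map, Polynomial.map_map, evalRoot_comp_of,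
    evalRoot_root]

end

section

variable {K : Type*} [Field K] {θ : RingAut K} {Fs : Type*} [Field Fs]
  [Algebra (fixedField θ) Fs]

/-! ### Partial skew residues -/

section PartialResidues

variable [IsSepClosure (fixedField θ) Fs] (hθ : IsOfFinOrder θ)
  (τ : ∀ z : Fs, z ≠ 0 → AdmissibleMorphism θ z)

theorem partialSkewResidue_infty (j : ℤ) (f : SkewFrac θ) :
    partialSkewResidue θ hθ τ j f ∞ =
      (-SkewLaurentSeries.coeff θ⁻¹ (orderOf θ - j) (taylorInfty θ hθ f)) ⊗ₜ 1 := rfl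

theorem partialSkewResidue_zero (j : ℤ) (f : SkewFrac θ) :
    partialSkewResidue θ hθ τ j f ((0 : Fs) : OnePoint Fs) =
      SkewLaurentSeries.coeff θ (j - orderOf θ) (taylorZero θ hθ f) ⊗ₜ 1 :=
  dif_pos rfl

theorem partialSkewResidue_coe (j : ℤ) (f : SkewFrac θ) {z : Fs} (hz : z ≠ 0) :
    partialSkewResidue θ hθ τ j f (z : OnePoint Fs) =
      iota θ z hz (secQuot θ hθ j _ ((τ z hz).skewResidue f)) :=
  dif_neg hz

theorem partialSkewResidue_add (j : ℤ) (f g : SkewFrac θ) (z : OnePoint Fs) :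
    partialSkewResidue θ hθ τ j (f + g) z =
      partialSkewResidue θ hθ τ j f z + partialSkewResidue θ hθ τ j g z := by
  induction z using OnePoint.rec with
  | infty =>
    simp only [partialSkewResidue_infty, map_add, neg_add, TensorProduct.add_tmul]
  | coe z =>
    rcases eq_or_ne z 0 with rfl | hz
    · simp only [partialSkewResidue_zero, map_add, TensorProduct.add_tmul]
    · simp only [partialSkewResidue_coe hθ τ j _ hz, AdmissibleMorphism.skewResidue, map_add,
        HahnSeries.coeff_add]

/-- The residues of `f` vanish for almost all points, and their sum is zero. -/
def SkewResidueFormula (f : SkewFrac θ) : Prop :=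
  (Function.support (partialSkewResidue θ hθ τ 0 f)).Finite ∧
    ∑ᶠ z : OnePoint Fs, partialSkewResidue θ hθ τ 0 f z = 0

theorem SkewResidueFormula.add {f g : SkewFrac θ} (hf : SkewResidueFormula hθ τ f)
    (hg : SkewResidueFormula hθ τ g) : SkewResidueFormula hθ τ (f + g) := by
  have e : partialSkewResidue θ hθ τ 0 (f + g) =
      fun z => partialSkewResidue θ hθ τ 0 f z + partialSkewResidue θ hθ τ 0 g z :=
    funext (partialSkewResidue_add hθ τ 0 f g)
  rw [SkewResidueFormula, e]
  refine ⟨(hf.1.union hg.1).subset (Function.support_add _ _), ?_⟩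
  rw [finsum_add_distrib hf.1 hg.1, hf.2, hg.2, add_zero]

theorem skewResidueFormula_of_eq_zero {f : SkewFrac θ}
    (h : ∀ z : OnePoint Fs, partialSkewResidue θ hθ τ 0 f z = 0) :
    SkewResidueFormula hθ τ f := by
  have e : partialSkewResidue θ hθ τ 0 f = fun _ => 0 := funext h
  rw [SkewResidueFormula, e]
  simp

/-! ### Residues of central multiples of constants -/

/-- All partial residues, at zero and infinity included, are images of classical residues under the
additive map `c ↦ a ⊗ c`, which carries the classical formula over. -/
theorem skewResidueFormula_of_central {p q : (fixedField θ)[X]} (hq : q ≠ 0)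
    (hs : (q.map (algebraMap (fixedField θ) Fs)).Splits) {a : K} {f : SkewFrac θ}
    (hf : toFrac θ (ofCenter θ q) * f = toFrac θ (SkewLaurent.C θ a * ofCenter θ p)) :
    SkewResidueFormula hθ τ f := by
  set h : RatFunc Fs := algebraMap Fs[X] (RatFunc Fs) (p.map (algebraMap (fixedField θ) Fs)) /
    algebraMap Fs[X] (RatFunc Fs) (q.map (algebraMap (fixedField θ) Fs)) with hh
  have hmul : ∀ c : fixedField θ, (a * (c : K)) ⊗ₜ[fixedField θ] (1 : Fs) =
      a ⊗ₜ algebraMap (fixedField θ) Fs c := by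
    intro c
    rw [Algebra.algebraMap_eq_smul_one, ← TensorProduct.smul_tmul, mul_comm]
    rfl
  have hinf : partialSkewResidue θ hθ τ 0 f ∞ = -(a ⊗ₜ negResidueInfty h) := by
    have h1 := taylorInfty_coeff hθ hq hf 1
    rw [mul_one] at h1
    rw [partialSkewResidue_infty, sub_zero, h1, TensorProduct.neg_tmul, hmul,
      map_negResidueInfty]
  have hcoe : ∀ z : Fs, partialSkewResidue θ hθ τ 0 f z = a ⊗ₜ residueAt z h := by
    intro z
    rcases eq_or_ne z 0 with rfl | hz
    · have h1 := taylorZero_coeff hθ hq hf (-1)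
      rw [mul_neg_one] at h1
      rw [partialSkewResidue_zero, zero_sub, h1, hmul, map_residueAt, map_zero]
    · rw [partialSkewResidue_coe hθ τ 0 f hz, iota_secQuot_skewResidue hθ hz _ hq hf]
  obtain ⟨hfin, hsum⟩ := residueFormula_div (p.map (algebraMap (fixedField θ) Fs)) _ hs
  rw [← hh] at hfin hsum
  have hsub : Function.support (partialSkewResidue θ hθ τ 0 f) ⊆
      insert ∞ (Set.image (↑) (Function.support fun z => residueAt z h)) := by
    intro z hz
    induction z using OnePoint.rec with
    | infty => exact Set.mem_insert _ _
    | coe z =>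
      refine Set.mem_insert_of_mem _ ⟨z, fun h0 => hz ?_, rfl⟩
      exact (hcoe z).trans ((congrArg (a ⊗ₜ ·) h0).trans (TensorProduct.tmul_zero _ _))
  refine ⟨((hfin.image _).insert _).subset hsub, ?_⟩
  have hcomp : partialSkewResidue θ hθ τ 0 f ∘ some =
      fun z => TensorProduct.mk (fixedField θ) K Fs a (residueAt z h) := funext hcoe
  have hsup : (Function.support (partialSkewResidue θ hθ τ 0 f ∘ some)).Finite := by
    rw [hcomp]
    exact hfin.subset (Function.support_comp_subset (map_zero _) _)
  -- `OnePoint Fs` is an option type, so the point at infinity can be separated from the sum.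
  refine (finsum_option hsup).trans ?_
  change partialSkewResidue θ hθ τ 0 f ∞ + ∑ᶠ z, (partialSkewResidue θ hθ τ 0 f ∘ some) z = 0
  rw [hcomp, hinf, ← hsum]
  change _ + ∑ᶠ z, (TensorProduct.mk (fixedField θ) K Fs a).toAddMonoidHom (residueAt z h) = 0
  rw [← AddMonoidHom.map_finsum _ hfin]
  exact neg_add_cancel _

/-! ### Vanishing of residues away from the central component -/

theorem coeff_mul_toSeries_C (s : SkewLaurentSeries θ) (b : K) (i : ℤ) :
    SkewLaurentSeries.coeff θ i (s * toSeries θ (SkewLaurent.C θ b)) =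
      SkewLaurentSeries.coeff θ i s * (θ ^ i) b := by
  obtain ⟨c, hc⟩ := s.2 i
  have h1 : toSeriesAux θ (SkewLaurent.C θ b) = HahnSeries.single 0 (mulEnd b) :=
    (toSeriesAux_monomial θ 0 b).trans (by simp)
  change ((s : LaurentSeries (Module.End ℤ K)) * toSeriesAux θ (SkewLaurent.C θ b)).coeff i 1 =
    (s : LaurentSeries (Module.End ℤ K)).coeff i 1 * _
  rw [h1, HahnSeries.coeff_mul_single_zero, hc]
  change c * (θ ^ i) (b * 1) = c * (θ ^ i) 1 * (θ ^ i) b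
  simp

theorem coeff_toSeries_C_mul (s : SkewLaurentSeries θ) (b : K) (i : ℤ) :
    SkewLaurentSeries.coeff θ i (toSeries θ (SkewLaurent.C θ b) * s) =
      b * SkewLaurentSeries.coeff θ i s := by
  have h1 : toSeriesAux θ (SkewLaurent.C θ b) = HahnSeries.single 0 (mulEnd b) :=
    (toSeriesAux_monomial θ 0 b).trans (by simp)
  change (toSeriesAux θ (SkewLaurent.C θ b) * (s : LaurentSeries (Module.End ℤ K))).coeff i 1 =
    b * (s : LaurentSeries (Module.End ℤ K)).coeff i 1
  rw [h1, HahnSeries.coeff_single_zero_mul]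
  rfl

theorem invertX_C (b : K) : invertX θ (SkewLaurent.C θ b) = SkewLaurent.C θ⁻¹ b :=
  (invertX_monomial θ 0 b).trans (by rw [neg_zero]; rfl)

/-- Only exponents divisible by the order of `θ` survive, and those powers of `X` commute with `b`.
This fails for a general `sec_j`, hence the index `0`. -/
theorem sec_zero_mul_C (f : SkewLaurent θ) (b : K) :
    sec θ 0 (f * SkewLaurent.C θ b) = LaurentPolynomial.C b * sec θ 0 f := by
  induction f using SkewLaurent.induction_on with
  | h0 => simp
  | ha f g hf hg => rw [add_mul, map_add, hf, hg, map_add, mul_add]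
  | hm n a =>
    change sec θ 0 (SkewLaurent.monomial θ n a * SkewLaurent.monomial θ 0 b) = _
    rw [SkewLaurent.monomial_mul_monomial, sec_monomial, sec_monomial, add_zero, sub_zero]
    split_ifs with h
    · rw [orderOf_dvd_iff_zpow_eq_one.1 h, RingAut.one_apply, map_mul]
      ring
    · simp

theorem sec_C_mul (j : ℤ) (f : SkewLaurent θ) (b : K) :
    sec θ j (SkewLaurent.C θ b * f) = LaurentPolynomial.C b * sec θ j f := by
  induction f using SkewLaurent.induction_on with
  | h0 => simp
  | ha f g hf hg => rw [mul_add, map_add, hf, hg, map_add, mul_add]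
  | hm n a =>
    change sec θ j (SkewLaurent.monomial θ 0 b * SkewLaurent.monomial θ n a) = _
    rw [SkewLaurent.monomial_mul_monomial, sec_monomial, sec_monomial, zero_add, zpow_zero,
      RingAut.one_apply]
    split_ifs with h
    · rw [map_mul, mul_assoc]
    · simp

/-- Applying `sec₀` to both sides of the relation gives `(b - c) sec₀(u) = 0`, and `b - c` is a
nonzero constant, hence a unit. -/
theorem secQuot_zero_eq_zero (N : (fixedField θ)[X]) (u : SkewQuot θ N) {b c : K} (hbc : b ≠ c)
    (hu : u * Ideal.Quotient.mk _ (SkewLaurent.C θ b) =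
      Ideal.Quotient.mk _ (SkewLaurent.C θ c) * u) :
    secQuot θ hθ 0 N u = 0 := by
  obtain ⟨g, rfl⟩ := Ideal.Quotient.mk_surjective u
  have h1 := congrArg (secQuot θ hθ 0 N) hu
  rw [← map_mul, ← map_mul] at h1
  change Ideal.Quotient.mk _ (sec θ 0 _) = Ideal.Quotient.mk _ (sec θ 0 _) at h1
  rw [sec_zero_mul_C, sec_C_mul, ← sub_eq_zero, ← map_sub, ← sub_mul, ← map_sub, map_mul] at h1
  change Ideal.Quotient.mk _ (sec θ 0 g) = 0
  have h2 : IsUnit (Ideal.Quotient.mk (Ideal.span {toLaurent θ N})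
      (LaurentPolynomial.C (b - c))) :=
    ((IsUnit.mk0 _ (sub_ne_zero.2 hbc)).map LaurentPolynomial.C).map _
  exact h2.mul_right_eq_zero.1 h1

/-- The relation `f b = c f` passes to every expansion. At zero and infinity it is read at exponents
`-r` and `r`, where the twist is trivial. At other points constants expand to constants, so it holds
for the coefficient of `T⁻¹`, whatever `τ` is. -/
theorem partialSkewResidue_eq_zero {f : SkewFrac θ} {b c : K} (hbc : b ≠ c)
    (hf : f * toFrac θ (SkewLaurent.C θ b) = toFrac θ (SkewLaurent.C θ c) * f)
    (z : OnePoint Fs) : partialSkewResidue θ hθ τ 0 f z = 0 := by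
  have key : ∀ x : K, x * b = c * x → x = 0 := by
    intro x hx
    have : x * (b - c) = 0 := by linear_combination hx
    exact (mul_eq_zero.1 this).resolve_right (sub_ne_zero.2 hbc)
  induction z using OnePoint.rec with
  | infty =>
    rw [partialSkewResidue_infty, sub_zero]
    have h1 := congrArg (fun f => SkewLaurentSeries.coeff θ⁻¹ (orderOf θ) (taylorInfty θ hθ f)) hf
    simp only [map_mul, taylorInfty, fracLift_toFrac, RingHom.comp_apply, invertX_C,
      coeff_mul_toSeries_C, coeff_toSeries_C_mul] at h1
    rw [zpow_natCast, inv_pow, pow_orderOf_eq_one, inv_one, RingAut.one_apply] at h1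
    rw [taylorInfty, key _ h1, neg_zero, TensorProduct.zero_tmul]
  | coe z =>
    rcases eq_or_ne z 0 with rfl | hz
    · rw [partialSkewResidue_zero, zero_sub]
      have h1 := congrArg (fun f => SkewLaurentSeries.coeff θ (-orderOf θ) (taylorZero θ hθ f)) hf
      simp only [map_mul, taylorZero, fracLift_toFrac,
        coeff_mul_toSeries_C, coeff_toSeries_C_mul] at h1
      rw [zpow_neg, zpow_natCast, pow_orderOf_eq_one, inv_one, RingAut.one_apply] at h1
      rw [taylorZero, key _ h1, TensorProduct.zero_tmul]
    · have hC : ∀ a, (τ z hz).taylor (toFrac θ (SkewLaurent.C θ a)) =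
          HahnSeries.single 0 (Ideal.Quotient.mk _ (SkewLaurent.C θ a)) := by
        intro a
        rw [AdmissibleMorphism.taylor, fracLift_toFrac, AdmissibleMorphism.toLaurentSeries,
          RingHom.comp_apply, RingHom.comp_apply, (τ z hz).map_C, HahnSeries.ofPowerSeries_C]
        rfl
      rw [partialSkewResidue_coe hθ τ 0 f hz, secQuot_zero_eq_zero hθ _ _ hbc, map_zero]
      have h1 := congrArg (fun f => ((τ z hz).taylor f).coeff (-1)) hf
      simp only [map_mul, hC] at h1
      rwa [HahnSeries.coeff_mul_single_zero, HahnSeries.coeff_single_zero_mul] at h1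

theorem toFrac_ofCenter_commute (D : (fixedField θ)[X]) (g : SkewLaurent θ) :
    Commute (toFrac θ (ofCenter θ D)) (toFrac θ g) :=
  (ofCenter_commute θ D g).map (toFrac θ)

theorem skewResidueFormula_of_monomial {D : (fixedField θ)[X]} (hD : D ≠ 0)
    (hs : (D.map (algebraMap (fixedField θ) Fs)).Splits) (n : ℤ) (a : K) {f : SkewFrac θ}
    (hf : toFrac θ (ofCenter θ D) * f = toFrac θ (SkewLaurent.monomial θ n a)) :
    SkewResidueFormula hθ τ f := by
  have hC : ∀ c m b, SkewLaurent.C θ c * SkewLaurent.monomial θ m b =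
      SkewLaurent.monomial θ m (c * b) := by
    intro c m b
    refine (SkewLaurent.monomial_mul_monomial θ 0 m c b).trans ?_
    simp
  by_cases hn : (orderOf θ : ℤ) ∣ n
  · obtain ⟨k, rfl⟩ := hn
    have hX : ∀ k : ℕ, ofCenter θ (Polynomial.X ^ k) =
        SkewLaurent.monomial θ (orderOf θ * k) 1 := by
      intro k
      rw [← Polynomial.monomial_one_right_eq_X_pow, ofCenter_monomial]
      rfl
    obtain ⟨k, rfl | rfl⟩ := k.eq_nat_or_neg
    · refine skewResidueFormula_of_central hθ τ (p := Polynomial.X ^ k) hD hs (a := a) ?_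
      rw [hf, hX, hC, mul_one]
    -- A negative power of `Y` joins the denominator; this only adds the root `0`, so the
    -- denominator still splits.
    · refine skewResidueFormula_of_central hθ τ (p := 1) (q := Polynomial.X ^ k * D)
        (mul_ne_zero (pow_ne_zero _ Polynomial.X_ne_zero) hD) ?_ (a := a) ?_
      · rw [Polynomial.map_mul, Polynomial.map_pow, Polynomial.map_X]
        exact (Polynomial.Splits.X.pow k).mul hs
      · rw [map_mul, map_mul, mul_assoc, hf, ← map_mul, hX, SkewLaurent.monomial_mul_monomial,
          zpow_mul, zpow_natCast, zpow_natCast, pow_orderOf_eq_one, one_pow, RingAut.one_apply, one_mul,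
          mul_neg, add_neg_cancel, map_one, mul_one]
        rfl
  -- Here `Xⁿ` is not central: for `b` moved by `θⁿ`, the relation `f b = θⁿ(b) f` makes every
  -- residue vanish.
  · have hθn : θ ^ n ≠ 1 := fun h => hn (orderOf_dvd_iff_zpow_eq_one.2 h)
    obtain ⟨b, hb⟩ : ∃ b, (θ ^ n) b ≠ b := by
      by_contra! h
      exact hθn (RingEquiv.ext h)
    refine skewResidueFormula_of_eq_zero hθ τ (partialSkewResidue_eq_zero hθ τ hb.symm ?_)
    refine (isUnit_toFrac_ofCenter θ D hD).mul_left_cancel ?_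
    rw [← mul_assoc, hf, ← mul_assoc, (toFrac_ofCenter_commute D _).eq, mul_assoc, hf, ← map_mul,
      ← map_mul, hC]
    congr 1
    refine (SkewLaurent.monomial_mul_monomial θ n 0 a b).trans ?_
    rw [add_zero, mul_comm]

theorem skewResidueFormula_of_polesIn {f : SkewFrac θ} (hf : PolesIn θ Fs f) :
    SkewResidueFormula hθ τ f := by
  obtain ⟨D, hD, hs, g, hg⟩ := hf
  induction g using SkewLaurent.induction_on generalizing f with
  | h0 =>
    refine skewResidueFormula_of_monomial hθ τ hD hs 0 0 ?_
    rw [hg, map_zero (SkewLaurent.monomial θ 0)]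
  | hm n a => exact skewResidueFormula_of_monomial hθ τ hD hs n a hg
  | ha g₁ g₂ h₁ h₂ =>
    -- The two summands of the numerator keep the denominator `D`, so the induction applies to `D⁻¹
    -- g₁` and `D⁻¹ g₂`.
    obtain ⟨u, hu⟩ := isUnit_toFrac_ofCenter θ D hD
    have e : ∀ g, toFrac θ (ofCenter θ D) * (↑u⁻¹ * toFrac θ g) = toFrac θ g := by
      intro g
      rw [← hu, Units.mul_inv_cancel_left]
    have hfe : f = ↑u⁻¹ * toFrac θ g₁ + ↑u⁻¹ * toFrac θ g₂ := by
      rw [← mul_add, ← map_add, ← hg, ← hu, Units.inv_mul_cancel_left]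
    rw [hfe]
    exact (h₁ (e g₁)).add hθ τ (h₂ (e g₂))

end PartialResidues

end

/-! ### The norm polynomial of an element of trace one -/

variable {K : Type*} [Field K] {θ : RingAut K}

theorem map_sum_range_orderOf (hθ : IsOfFinOrder θ) (a : K) :
    θ (∑ i ∈ Finset.range (orderOf θ), (θ ^ i) a) = ∑ i ∈ Finset.range (orderOf θ), (θ ^ i) a := by
  obtain ⟨n, hn⟩ := Nat.exists_eq_succ_of_ne_zero hθ.orderOf_pos.ne'
  have h1 : (θ ^ (n + 1)) a = a := by
    rw [← Nat.succ_eq_add_one, ← hn, pow_orderOf_eq_one, RingAut.one_apply]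
  simp_rw [map_sum, ← RingAut.mul_apply, ← pow_succ']
  rw [hn, Finset.sum_range_succ, Finset.sum_range_succ', h1, pow_zero, RingAut.one_apply]

/-- The powers of `θ` below its order are distinct characters, so by Dedekind independence their sum
is not identically zero. Its values are fixed by `θ`, so a nonzero one can be divided out. -/
theorem exists_trace_eq_one (hθ : IsOfFinOrder θ) :
    ∃ a : K, ∑ i ∈ Finset.range (orderOf θ), (θ ^ i) a = 1 := by
  have h1 : ∃ a : K, ∑ i ∈ Finset.range (orderOf θ), (θ ^ i) a ≠ 0 := by
    by_contra! h
    have hinj : Function.Injective fun i : Fin (orderOf θ) =>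
        (((θ ^ (i : ℕ) : RingAut K) : K →+* K) : K →* K) := by
      intro i j hij
      refine Fin.ext (pow_injOn_Iio_orderOf i.2 j.2 (RingEquiv.ext fun x => ?_))
      exact DFunLike.congr_fun hij x
    have hl := Fintype.linearIndependent_iff.1
      ((linearIndependent_monoidHom K K).comp _ hinj) (fun _ => 1) (by
        funext x
        refine Eq.trans ?_ ((Fin.sum_univ_eq_sum_range (fun i => (θ ^ i) x) _).trans (h x))
        simp)
    exact one_ne_zero (hl ⟨0, hθ.orderOf_pos⟩)
  obtain ⟨a, ha⟩ := h1
  set t := ∑ i ∈ Finset.range (orderOf θ), (θ ^ i) a with ht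
  have hθt : ∀ i : ℕ, (θ ^ i) t = t := by
    intro i
    induction i with
    | zero => rfl
    | succ i ih => rw [pow_succ, RingAut.mul_apply, map_sum_range_orderOf hθ, ih]
  refine ⟨a / t, ?_⟩
  simp_rw [map_div₀, hθt]
  rw [← Finset.sum_div, ← ht, div_self ha]

variable (θ) in
/-- The polynomial `∏_{i < n} (1 + θⁱ(a) S)`. -/
def normPoly (a : K) (n : ℕ) : K[X] :=
  ∏ i ∈ Finset.range n, (1 + Polynomial.C ((θ ^ i) a) * Polynomial.X)

theorem normPoly_coeff_zero (a : K) (n : ℕ) : (normPoly θ a n).coeff 0 = 1 := by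
  rw [normPoly, Polynomial.coeff_zero_prod]
  simp

theorem normPoly_coeff_one (a : K) (n : ℕ) :
    (normPoly θ a n).coeff 1 = ∑ i ∈ Finset.range n, (θ ^ i) a := by
  induction n with
  | zero => simp [normPoly, Polynomial.coeff_one]
  | succ n ih =>
    rw [Finset.sum_range_succ, ← ih]
    have h0 := normPoly_coeff_zero (θ := θ) a n
    rw [normPoly] at h0 ⊢
    rw [Finset.prod_range_succ, Polynomial.mul_coeff_one, h0]
    simp [Polynomial.coeff_one, add_comm, normPoly]

/-- Applying `θ` to the coefficients permutes the factors cyclically, so the coefficients of the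
product lie in `F`. -/
theorem exists_map_eq_normPoly (hθ : IsOfFinOrder θ) (a : K) :
    ∃ P : (fixedField θ)[X], P.map (fixedField θ).subtype = normPoly θ a (orderOf θ) := by
  have h : (normPoly θ a (orderOf θ)).map (θ : K →+* K) = normPoly θ a (orderOf θ) := by
    obtain ⟨n, hn⟩ := Nat.exists_eq_succ_of_ne_zero hθ.orderOf_pos.ne'
    have h1 : (θ ^ (n + 1)) a = a := by
      rw [← Nat.succ_eq_add_one, ← hn, pow_orderOf_eq_one, RingAut.one_apply]
    have h2 : ∀ i : ℕ, (θ : K →+* K) ((θ ^ i) a) = (θ ^ (i + 1)) a := by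
      intro i
      rw [pow_succ', RingAut.mul_apply]
      rfl
    simp only [normPoly, Polynomial.map_prod, Polynomial.map_add, Polynomial.map_one,
      Polynomial.map_mul, Polynomial.map_C, Polynomial.map_X, h2]
    rw [hn, Finset.prod_range_succ, Finset.prod_range_succ', h1, pow_zero, RingAut.one_apply]
  have hl : normPoly θ a (orderOf θ) ∈ Polynomial.lifts (fixedField θ).subtype := by
    rw [Polynomial.lifts_iff_coeff_lifts]
    intro n
    refine ⟨⟨(normPoly θ a (orderOf θ)).coeff n, ?_⟩, rfl⟩
    change θ _ = _
    conv_rhs => rw [← h, Polynomial.coeff_map]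
    rfl
  obtain ⟨P, hP⟩ := (Polynomial.mem_lifts _).1 hl
  exact ⟨P, hP⟩

/-- A polynomial `1 + S + ⋯` takes the value `1 + T` at some power series without constant term. -/
theorem exists_aeval_eq_one_add_X {F : Type*} [Field F] (P : F[X]) (h0 : P.coeff 0 = 1)
    (h1 : P.coeff 1 = 1) : ∃ G : PowerSeries F, PowerSeries.constantCoeff G = 0 ∧
      Polynomial.aeval G P = 1 + PowerSeries.X := by
  have hQ : PowerSeries.coeff 1 ((P - 1 : F[X]) : PowerSeries F) = 1 := by
    rw [Polynomial.coeff_coe, Polynomial.coeff_sub, h1]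
    simp [Polynomial.coeff_one]
  let : Invertible (PowerSeries.coeff 1 ((P - 1 : F[X]) : PowerSeries F)) :=
    invertibleOfNonzero (by rw [hQ]; exact one_ne_zero)
  -- `P - 1 = S + ⋯` has no constant term and an invertible linear coefficient, so it has a
  -- compositional inverse; this is the required series.
  have h2 := PowerSeries.subst_substInv_right ((P - 1 : F[X]) : PowerSeries F)
    (by rw [← PowerSeries.coeff_zero_eq_constantCoeff_apply, Polynomial.coeff_coe]; simp [h0])
  rw [PowerSeries.subst_coe (PowerSeries.HasSubst.substInv _), map_sub, map_one,
    sub_eq_iff_eq_add'] at h2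
  exact ⟨_, PowerSeries.constantCoeff_substInv _, h2⟩

/-! ### Extension of homomorphisms to the completion -/

section Completion

variable {R : Type*} [Ring R] {N : (fixedField θ)[X]} (φ : SkewLaurent θ →+* PowerSeries R)

/-- The image of `N` has order at least `1`, so that of a multiple of `N^m` has order at least `m`.
-/
theorem coeff_map_eq_zero (hφ : PowerSeries.constantCoeff (φ (ofCenter θ N)) = 0) {m k : ℕ} (hk : k < m) {f : SkewLaurent θ}
    (hf : f ∈ skewIdeal θ (N ^ m)) : PowerSeries.coeff k (φ f) = 0 := by
  obtain ⟨g, rfl⟩ := Ideal.mem_span_singleton'.1 hf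
  refine PowerSeries.coeff_of_lt_order _ (lt_of_lt_of_le (Nat.cast_lt.2 hk) ?_)
  rw [map_mul, map_pow, map_pow]
  exact (PowerSeries.le_order_pow_of_constantCoeff_eq_zero m hφ).trans
    (le_add_self.trans (PowerSeries.le_order_mul _ _))

variable (hφ : PowerSeries.constantCoeff (φ (ofCenter θ N)) = 0)

/-- The map induced on `𝒜/N^{k+1}𝒜` by the `k`-th coefficient of `φ`. -/
def coeffQuot (k : ℕ) : SkewQuot θ (N ^ (k + 1)) →+ R :=
  QuotientAddGroup.lift (skewIdeal θ (N ^ (k + 1))).toAddSubgroup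
    ((PowerSeries.coeff (R := R) k).toAddMonoidHom.comp φ.toAddMonoidHom)
    (fun _ hf => coeff_map_eq_zero φ hφ k.lt_succ_self hf)

/-- Any representative at any level beyond `k` computes the `k`-th coefficient, so one
representative serves for several coefficients. -/
theorem coeffQuot_apply (x : SkewCompletion θ N) {m k : ℕ} (hk : k < m) (f : SkewLaurent θ)
    (hf : Ideal.Quotient.mk _ f = x.1 m) :
    coeffQuot φ hφ k (x.1 (k + 1)) = PowerSeries.coeff k (φ f) := by
  rw [← x.2 (k + 1) m hk, ← hf]
  rfl

/-- The extension to the completion of a homomorphism `𝒜 → R[[T]]` which sends `N` to a multiple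
of `T`. -/
def completionLift : SkewCompletion θ N →+* PowerSeries R where
  toFun x := PowerSeries.mk fun k => coeffQuot φ hφ k (x.1 (k + 1))
  map_zero' := by
    ext k
    rw [PowerSeries.coeff_mk, coeffQuot_apply φ hφ 0 k.lt_succ_self 0 (map_zero _), map_zero]
  map_one' := by
    ext k
    rw [PowerSeries.coeff_mk, coeffQuot_apply φ hφ 1 k.lt_succ_self 1 (map_one _), map_one]
  map_add' x y := by
    ext k
    rw [map_add, PowerSeries.coeff_mk, PowerSeries.coeff_mk, PowerSeries.coeff_mk, ← map_add]
    rfl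
  map_mul' x y := by
    ext k
    -- Representatives modulo `N^{k+1}` give all coefficients of index at most `k`, which are the
    -- only ones in the Cauchy product.
    obtain ⟨f, hf⟩ := Ideal.Quotient.mk_surjective (x.1 (k + 1))
    obtain ⟨g, hg⟩ := Ideal.Quotient.mk_surjective (y.1 (k + 1))
    rw [PowerSeries.coeff_mk, coeffQuot_apply φ hφ (x * y) k.lt_succ_self (f * g)
      ((map_mul _ _ _).trans (congrArg₂ _ hf hg)), map_mul, PowerSeries.coeff_mul,
      PowerSeries.coeff_mul]
    refine Finset.sum_congr rfl fun ij hij => ?_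
    have hij' := Finset.HasAntidiagonal.mem_antidiagonal.1 hij
    rw [PowerSeries.coeff_mk, PowerSeries.coeff_mk,
      coeffQuot_apply φ hφ x (by omega) f hf, coeffQuot_apply φ hφ y (by omega) g hg]

theorem completionLift_toCompletion (f : SkewLaurent θ) :
    completionLift φ hφ (toCompletion θ N f) = φ f := by
  ext k
  exact (PowerSeries.coeff_mk k
    fun k => coeffQuot φ hφ k ((toCompletion θ N f).1 (k + 1))).trans
    (coeffQuot_apply φ hφ (toCompletion θ N f) k.lt_succ_self f rfl)

end Completion

/-! ### Existence of admissible morphisms -/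

theorem centerQuot_commute (N : (fixedField θ)[X]) (u : AdjoinRoot N) (v : SkewQuot θ N) :
    Commute (centerQuot θ N u) v := by
  obtain ⟨g, rfl⟩ := Ideal.Quotient.mk_surjective v
  induction u using AdjoinRoot.induction_on with
  | ih p =>
    rw [centerQuot_mk]
    exact (ofCenter_commute θ p g).map _

theorem commute_map_centerQuot (N : (fixedField θ)[X]) (s : PowerSeries (AdjoinRoot N))
    (v : SkewQuot θ N) :
    Commute (PowerSeries.map (centerQuot θ N) s) (PowerSeries.C v) := by
  ext k
  rw [PowerSeries.coeff_mul_C, PowerSeries.coeff_C_mul, PowerSeries.coeff_map]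
  exact centerQuot_commute N _ v

variable (θ) in
/-- The constants `K → (𝒜/N𝒜)[[T]]`. -/
def constSeries (N : (fixedField θ)[X]) : K →+* PowerSeries (SkewQuot θ N) :=
  PowerSeries.C.comp ((Ideal.Quotient.mk _).comp (SkewLaurent.C θ))

variable (θ) in
/-- The series `(1 + a g) X` in `(𝒜/N𝒜)[[T]]`, for a series `g` with coefficients in `F[Y]/N`. -/
def twistedX (N : (fixedField θ)[X]) (a : K) (g : PowerSeries (AdjoinRoot N)) :
    PowerSeries (SkewQuot θ N) :=
  (1 + constSeries θ N a * PowerSeries.map (centerQuot θ N) g) *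
    PowerSeries.C (Ideal.Quotient.mk _ (SkewLaurent.X θ))

theorem C_X_pow_mul_constSeries (N : (fixedField θ)[X]) (n : ℕ) (b : K) :
    (PowerSeries.C (Ideal.Quotient.mk (skewIdeal θ N) (SkewLaurent.X θ))) ^ n *
        constSeries θ N b = constSeries θ N ((θ ^ n) b) *
      (PowerSeries.C (Ideal.Quotient.mk (skewIdeal θ N) (SkewLaurent.X θ))) ^ n := by
  simp only [constSeries, RingHom.comp_apply, ← map_pow, ← map_mul]
  congr 2
  rw [SkewLaurent.X_pow]
  change SkewLaurent.monomial θ n 1 * SkewLaurent.monomial θ 0 b =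
    SkewLaurent.monomial θ 0 _ * SkewLaurent.monomial θ n 1
  rw [SkewLaurent.monomial_mul_monomial, SkewLaurent.monomial_mul_monomial]
  simp

theorem commute_constSeries (N : (fixedField θ)[X]) (g : PowerSeries (AdjoinRoot N)) (b : K) :
    Commute (constSeries θ N b) (PowerSeries.map (centerQuot θ N) g) :=
  (commute_map_centerQuot N g _).symm

/-- The factor `1 + a g` commutes with `K`, as `g` has central coefficients; hence the relation `X b
= θ(b) X` persists and `X ↦ (1 + a g) X` extends to `𝒜`. -/
theorem twistedX_mul_constSeries (N : (fixedField θ)[X]) (a : K)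
    (g : PowerSeries (AdjoinRoot N)) (b : K) :
    twistedX θ N a g * constSeries θ N b = constSeries θ N (θ b) * twistedX θ N a g := by
  have h1 := C_X_pow_mul_constSeries N 1 b
  rw [pow_one, pow_one] at h1
  have h2 : Commute (1 + constSeries θ N a * PowerSeries.map (centerQuot θ N) g)
      (constSeries θ N (θ b)) :=
    (Commute.one_left _).add_left
      (((Commute.all a (θ b)).map (constSeries θ N)).mul_left (commute_constSeries N g _).symm)
  rw [twistedX, mul_assoc, h1, ← mul_assoc, h2.eq, mul_assoc]

/-- Evaluation at `g` of polynomials with coefficients in `K`. -/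
def evalSeries (N : (fixedField θ)[X]) (g : PowerSeries (AdjoinRoot N)) :
    K[X] →+* PowerSeries (SkewQuot θ N) :=
  Polynomial.eval₂RingHom' (constSeries θ N) (PowerSeries.map (centerQuot θ N) g)
    (commute_constSeries N g)

theorem evalSeries_C (N : (fixedField θ)[X]) (g : PowerSeries (AdjoinRoot N)) (b : K) :
    evalSeries N g (Polynomial.C b) = constSeries θ N b := Polynomial.eval₂_C _ _

theorem evalSeries_X (N : (fixedField θ)[X]) (g : PowerSeries (AdjoinRoot N)) :
    evalSeries N g Polynomial.X = PowerSeries.map (centerQuot θ N) g := Polynomial.eval₂_X _ _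

/-- Moving `Xⁱ` to the right past `1 + a g` turns the factor into `1 + θⁱ(a) g`; these factors make
up the norm polynomial. -/
theorem twistedX_pow (N : (fixedField θ)[X]) (a : K) (g : PowerSeries (AdjoinRoot N)) (n : ℕ) :
    twistedX θ N a g ^ n = evalSeries N g (normPoly θ a n) *
      (PowerSeries.C (Ideal.Quotient.mk (skewIdeal θ N) (SkewLaurent.X θ))) ^ n := by
  induction n with
  | zero => simp [normPoly]
  | succ n ih =>
    have h1 := C_X_pow_mul_constSeries N n a
    have h2 := ((commute_map_centerQuot N g
      (Ideal.Quotient.mk (skewIdeal θ N) (SkewLaurent.X θ))).pow_right n).eq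
    have h3 : evalSeries N g (normPoly θ a (n + 1)) = evalSeries N g (normPoly θ a n) *
        (1 + constSeries θ N ((θ ^ n) a) * PowerSeries.map (centerQuot θ N) g) := by
      rw [normPoly, Finset.prod_range_succ, ← normPoly, map_mul, map_add, map_one, map_mul,
        evalSeries_C, evalSeries_X]
    rw [pow_succ, ih, h3, pow_succ, twistedX]
    simp only [mul_assoc]
    congr 1
    simp only [← mul_assoc]
    congr 1
    rw [mul_add, add_mul, mul_one, one_mul, ← mul_assoc, h1, mul_assoc, mul_assoc, h2]

/-- A polynomial over `F` is evaluated inside the commutative ring `(F[Y]/N)[[T]]`, where the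
equation for `g` can be solved. -/
theorem evalSeries_map (N : (fixedField θ)[X]) (g : PowerSeries (AdjoinRoot N))
    (P : (fixedField θ)[X]) :
    evalSeries N g (P.map (fixedField θ).subtype) =
      PowerSeries.map (centerQuot θ N)
        (P.eval₂ (PowerSeries.C.comp (AdjoinRoot.of N)) g) := by
  have h : (evalSeries N g).comp (Polynomial.mapRingHom (fixedField θ).subtype) =
      (PowerSeries.map (centerQuot θ N)).comp
        (Polynomial.eval₂RingHom (PowerSeries.C.comp (AdjoinRoot.of N)) g) := by
    refine Polynomial.ringHom_ext (fun b => ?_) ?_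
    · simp only [RingHom.comp_apply, Polynomial.coe_mapRingHom, Polynomial.map_C, evalSeries_C,
        Polynomial.coe_eval₂RingHom, Polynomial.eval₂_C, PowerSeries.map_C, centerQuot_of]
      rfl
    · simp only [RingHom.comp_apply, Polynomial.coe_mapRingHom, Polynomial.map_X, evalSeries_X,
        Polynomial.coe_eval₂RingHom, Polynomial.eval₂_X]
  exact DFunLike.congr_fun h P

/-- A polynomial `1 + S + ⋯` takes the value `1 + y⁻¹ T` at some power series without constant term
over an extension field `E`, for `y ∈ E`. -/
theorem exists_eval₂_eq_one_add {F E : Type*} [Field F] [Field E] (σ : F →+* E) (y : E) (P : F[X])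
    (h0 : P.coeff 0 = 1) (h1 : P.coeff 1 = 1) : ∃ g : PowerSeries E,
      PowerSeries.constantCoeff g = 0 ∧
        P.eval₂ (PowerSeries.C.comp σ) g = 1 + PowerSeries.C y⁻¹ * PowerSeries.X := by
  obtain ⟨G, hG0, hG⟩ := exists_aeval_eq_one_add_X P h0 h1
  -- The solution over `F` for `1 + T` is moved to `E` and rescaled by `T ↦ y⁻¹ T`.
  let ρ : PowerSeries F →+* PowerSeries E := (PowerSeries.rescale y⁻¹).comp (PowerSeries.map σ)
  refine ⟨ρ G, ?_, ?_⟩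
  · rw [← PowerSeries.coeff_zero_eq_constantCoeff_apply, RingHom.comp_apply,
      PowerSeries.coeff_rescale, PowerSeries.coeff_map,
      PowerSeries.coeff_zero_eq_constantCoeff_apply, hG0, map_zero, mul_zero]
  · have h := congrArg ρ hG
    rw [Polynomial.aeval_def, Polynomial.hom_eval₂] at h
    have hρ : ρ.comp (algebraMap F (PowerSeries F)) = PowerSeries.C.comp σ := by
      ext a n
      simp only [ρ, RingHom.comp_apply, PowerSeries.algebraMap_apply, Algebra.algebraMap_self,
        RingHom.id_apply, PowerSeries.map_C, PowerSeries.coeff_rescale, PowerSeries.coeff_C]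
      split_ifs with hn <;> simp [hn]
    rw [hρ] at h
    rw [h, map_add, map_one]
    simp [ρ, PowerSeries.rescale_X]

theorem nonempty_admissibleMorphism (hθ : IsOfFinOrder θ) {Fs : Type*} [Field Fs]
    [Algebra (fixedField θ) Fs] {z : Fs} (hint : IsIntegral (fixedField θ) z) (hz : z ≠ 0) :
    Nonempty (AdmissibleMorphism θ z) := by
  set N := minpoly (fixedField θ) z
  have : Fact (Irreducible N) := ⟨minpoly.irreducible hint⟩
  -- The hypothesis `z ≠ 0` makes `y`, the class of `Y`, invertible; this is needed both to form
  -- `y⁻¹ T` and to invert the image of `X`.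
  have hroot : AdjoinRoot.root N ≠ 0 := fun h => hz
    ((evalRoot_root (θ := θ) z).symm.trans ((congrArg (evalRoot z) h).trans (map_zero _)))
  obtain ⟨a, ha⟩ := exists_trace_eq_one hθ
  obtain ⟨P, hP⟩ := exists_map_eq_normPoly hθ a
  have hP0 : P.coeff 0 = 1 := by
    apply Subtype.ext
    have := normPoly_coeff_zero (θ := θ) a (orderOf θ)
    rwa [← hP, Polynomial.coeff_map] at this
  have hP1 : P.coeff 1 = 1 := by
    apply Subtype.ext
    have := normPoly_coeff_one (θ := θ) a (orderOf θ)
    rwa [← hP, Polynomial.coeff_map, ha] at this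
  obtain ⟨g, hg0, hg⟩ := exists_eval₂_eq_one_add (AdjoinRoot.of N) (AdjoinRoot.root N) P hP0 hP1
  have hX : PowerSeries.map (centerQuot θ N) (PowerSeries.C (AdjoinRoot.root N)) =
      (PowerSeries.C (Ideal.Quotient.mk (skewIdeal θ N) (SkewLaurent.X θ))) ^ orderOf θ := by
    rw [PowerSeries.map_C, centerQuot_root, map_pow, map_pow]
  -- The factor `P(g)` equals `1 + y⁻¹ T` and `X^r` is `y`, so the product is `y + T`.
  have hpow : twistedX θ N a g ^ orderOf θ = PowerSeries.map (centerQuot θ N)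
      (PowerSeries.C (AdjoinRoot.root N) + PowerSeries.X) := by
    rw [twistedX_pow, ← hP, evalSeries_map, hg, ← hX, ← map_mul]
    congr 1
    rw [add_mul, one_mul, mul_right_comm, ← map_mul, inv_mul_cancel₀ hroot, map_one, one_mul]
  have hunit : IsUnit (twistedX θ N a g) := by
    -- It is enough that the `r`-th power `y + T` is a unit, which holds because its constant term
    -- is.
    rw [← isUnit_pow_iff hθ.orderOf_pos.ne', hpow]
    refine IsUnit.map _ (PowerSeries.isUnit_iff_constantCoeff.2 ?_)
    simpa using hroot
  obtain ⟨x, hx⟩ := hunit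
  let φ : SkewLaurent θ →+* PowerSeries (SkewQuot θ N) :=
    SkewLaurent.lift θ (constSeries θ N) x (fun b => by
      rw [hx]; exact twistedX_mul_constSeries N a g b)
  have hφC : ∀ b, φ (SkewLaurent.C θ b) = constSeries θ N b := fun b =>
    (SkewLaurent.lift_monomial θ _ _ _ 0 b).trans (by simp)
  have hφX : φ (SkewLaurent.X θ) = twistedX θ N a g :=
    (SkewLaurent.lift_monomial θ _ _ _ 1 1).trans (by simp [hx])
  have hφY : φ (SkewLaurent.X θ ^ orderOf θ) =
      PowerSeries.C (Ideal.Quotient.mk _ (SkewLaurent.X θ ^ orderOf θ)) + PowerSeries.X := by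
    rw [map_pow, hφX, hpow, map_add, PowerSeries.map_C, centerQuot_root, PowerSeries.map_X]
  -- On `F[Y]` the constant term of `φ` is reduction modulo `N`, which kills `N`; hence `φ` extends
  -- to the completion.
  have hφ : PowerSeries.constantCoeff (φ (ofCenter θ N)) = 0 := by
    have h : PowerSeries.constantCoeff.comp (φ.comp (ofCenter θ)) =
        (Ideal.Quotient.mk (skewIdeal θ N)).comp (ofCenter θ) := by
      refine Polynomial.ringHom_ext (fun b => ?_) ?_
      · simp only [RingHom.comp_apply, ofCenter_C, hφC, constSeries,
          PowerSeries.constantCoeff_C]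
      · simp only [RingHom.comp_apply, ofCenter_X, hφY, map_add, PowerSeries.constantCoeff_C,
          PowerSeries.constantCoeff_X, add_zero]
    refine (DFunLike.congr_fun h N).trans (Ideal.Quotient.eq_zero_iff_mem.2 ?_)
    exact Ideal.mem_span_singleton_self _
  exact ⟨{
    toRingHom := completionLift φ hφ
    map_C := fun b => (completionLift_toCompletion φ hφ _).trans (hφC b)
    map_X := by
      rw [completionLift_toCompletion, hφX, twistedX, map_mul, map_add, map_mul]
      have : PowerSeries.constantCoeff (PowerSeries.map (centerQuot θ N) g) = 0 := by
        rw [← PowerSeries.coeff_zero_eq_constantCoeff_apply, PowerSeries.coeff_map,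
          PowerSeries.coeff_zero_eq_constantCoeff_apply, hg0, map_zero]
      rw [this, mul_zero, map_one, add_zero, one_mul, PowerSeries.constantCoeff_C]
    map_Y := (completionLift_toCompletion φ hφ _).trans hφY }⟩

end SkewResidue

end

theorem mainTheorem2 {K : Type*} [Field K] (θ : RingAut K) (hθ : IsOfFinOrder θ)
    {Fs : Type*} [Field Fs] [Algebra (SkewResidue.fixedField θ) Fs]
    [IsSepClosure (SkewResidue.fixedField θ) Fs] :
    (∀ z : Fs, z ≠ 0 → Nonempty (SkewResidue.AdmissibleMorphism θ z)) ∧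
    ∀ (τ : ∀ z : Fs, z ≠ 0 → SkewResidue.AdmissibleMorphism θ z) (f : SkewResidue.SkewFrac θ),
      SkewResidue.PolesIn θ Fs f →
      (Function.support (SkewResidue.partialSkewResidue θ hθ τ 0 f)).Finite ∧
      ∑ᶠ z : OnePoint Fs, SkewResidue.partialSkewResidue θ hθ τ 0 f z = 0 := by
  have : Algebra.IsSeparable (SkewResidue.fixedField θ) Fs := IsSepClosure.separable
  exact ⟨fun z hz => SkewResidue.nonempty_admissibleMorphism hθ
      (Algebra.IsIntegral.isIntegral z) hz,
    fun τ f hf => SkewResidue.skewResidueFormula_of_polesIn hθ τ hf⟩
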